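/- Let $p\ge q\ge 1$ and let $\mathbb R^{p,q}$ be $\mathbb R^{p+q}$ with $\langle x,y\rangle=\sum_{i=1}^p x^iy^i-\sum_{j=1}^q x^{p+j}y^{p+j}$ and standard basis $e_1,\dots,e_{p+q}$. Put $w_i=e_{p-i+1}-e_{p+i}$ and $\Pi_i=w_i^\perp=\{x^{p-i+1}+x^{p+i}=0\}$ for $1\le i\le q$, $\Pi_0=\mathbb R^{p,q}$, $\mathbb W^p=\bigcap_{i=1}^q\Pi_i$, and for $p\le m\le p+q-1$ $$\Sigma_m=\bigcap_{i=0}^{p+q-m-1}\Pi_i\ \setminus\ \bigcap_{i=0}^{p+q-m}\Pi_i .$$ Let $\Lambda=\{x\ne0:\langle x,x\rangle=0\}$, $\mathbb H(r)=\{\langle x,x\rangle=-r^2\}$, $\mathbb S(r)=\{\langle x,x\rangle=r^2\}$ for $r>0$, let $S_0(r)$ be the Euclidean sphere of radius $r$ about $0$ in $\mathbb Re_1\oplus\dots\oplus\mathbb Re_{p-q}$ (empty if $p=q$), and let $C(r)=S_0(r)+\sum_{j=1}^q\mathbb Rw_j$. Let $\mathfrak a\subset\mathfrak{so}(p,q)$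 be the abelian subalgebra of the matrices $H_c$, $c\in\mathbb R^q$, with $H_ce_{p-i+1}=c_ie_{p+i}$, $H_ce_{p+i}=c_ie_{p-i+1}$ for $1\le i\le q$ and $H_ce_k=0$ for $k\le p-q$. Put $f_i(H_c)=-c_i$, and let $\mathfrak n$ be the sum of the root spaces $\{X\in\mathfrak{so}(p,q):[H,X]=\lambda(H)X\ \ \forall H\in\mathfrak a\}$ over $\lambda\in\{f_i\pm f_j: i<j\}\cup\{f_l\}$. Let $A$, $N$ and $K_0\cong SO(p-q)$ be the connected Lie subgroups with Lie algebras $\mathfrak a$, $\mathfrak n$ and $\mathfrak k_0=\mathfrak{so}(p-q)$ (acting on the first $p-q$ coordinates). Let $K'\subseteq K_0$ be a subgroup. For a group $G$ of matrices, $\dim G(x)$ denotes the dimension of the tangent space $\{Xx: X\in\mathrm{Lie}(G)\}$ of the orbit at $x$, where $\mathrm{Lie}(G)=\{X:\exp(tX)\in G\ \forall t\in\mathbb R\}$. Then $G=K'AN$ is a group, and the following hold. (a) For $x\in\Lambda$, $\dim G(x)\in\{1,\dots,q\}\cup\{p,\dots,p+q-1\}$. For every $m$ in this set, except for $m=p$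 when $p=q$, there are exactly two $m$-dimensional orbits in $\Lambda$. They are $\sum_{i<m}\mathbb Rw_i+\mathbb R_+w_m$ and $\sum_{i<m}\mathbb Rw_i+\mathbb R_-w_m$ if $m\le q$, and they are the connected components of $\Lambda\cap\Sigma_m$ if $m\ge p$. If $p=q=m$, there are exactly four $m$-dimensional orbits in $\Lambda$: the two sets $\sum_{i<m}\mathbb Rw_i+\mathbb R_\pm w_m$ and the two connected components of $\Lambda\cap\Sigma_m$. For $x\in\Lambda$ the orbit $G(x)$ does not depend on the choice of $K'\subseteq K_0$. (b) Let $r>0$. For $x\in\mathbb H(r)$, $\dim G(x)\in\{p,\dots,p+q-1\}$. For each $m$ in this set there are exactly two $m$-dimensional orbits in $\mathbb H(r)$, namely the connected components of $\mathbb H(r)\cap\Sigma_m$. For $x\in\mathbb H(r)$ the orbit $G(x)$ does not depend on the choice of $K'$. (c) Let $r>0$. For $x\in\mathbb S(r)$, $\dim G(x)\in\{q,\dots,p+q-1\}$. For each $m\in\{p,\dots,p+q-1\}$ there are exactly two $m$-dimensional orbits in $\mathbb S(r)$, namely the connected components of $\mathbb S(r)\cap\Sigma_m$, and these orbits do not depend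 on the choice of $K'$. Moreover $\mathbb S(r)\cap\mathbb W^p=C(r)$. A point $x\in\mathbb S(r)$ satisfies $\dim G(x)\in\{q,\dots,p-1\}$ if and only if $x\in C(r)$, and for $x=y+\sum_{j=1}^q s_jw_j\in C(r)$ with $y\in S_0(r)$ and $s_j\in\mathbb R$, $$G(x)=K'(y)\times\sum_{j=1}^q\mathbb Rw_j=K'(y)+\sum_{j=1}^q\mathbb Rw_j .$$ -/

import Mathlib

open scoped Matrix Pointwise

namespace KANOrbits

/-- The coordinate space of `ℝ^{p,q}`: `Sum.inl i` is the (0-based) coordinate `i` among the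
first `p` ones, and `Sum.inr j` is the coordinate `j` among the last `q` ones. -/
abbrev Vec (p q : ℕ) : Type := Fin p ⊕ Fin q → ℝ

/-- Square real matrices of size `p + q`, in blocks. -/
abbrev Mat (p q : ℕ) : Type := Matrix (Fin p ⊕ Fin q) (Fin p ⊕ Fin q) ℝ

/-- The scalar product of signature `(p,q)`. -/
def form {p q : ℕ} (x y : Vec p q) : ℝ :=
  ∑ i : Fin p, x (Sum.inl i) * y (Sum.inl i) - ∑ j : Fin q, x (Sum.inr j) * y (Sum.inr j)

/-- The null cone (nonzero light-like vectors). -/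
def nullCone (p q : ℕ) : Set (Vec p q) := {x | x ≠ 0 ∧ form x x = 0}

/-- The pseudo-hyperbolic space of radius `r`. -/
def pseudoHyperbolic (p q : ℕ) (r : ℝ) : Set (Vec p q) := {x | form x x = -r ^ 2}

/-- The pseudo-sphere of radius `r`. -/
def pseudoSphere (p q : ℕ) (r : ℝ) : Set (Vec p q) := {x | form x x = r ^ 2}

/-- For the 1-based index `i` in `{1, …, q}` this is the coordinate `p - i + 1` in `{1, …, p}`;
in 0-based terms `i ↦ p - 1 - i`. -/
def mir {p q : ℕ} (h : q ≤ p) (i : Fin q) : Fin p := (Fin.castLE h i).rev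

/-- The null vector `w_i = e_{p-i+1} - e_{p+i}` (here `i` is 0-based). -/
def w {p q : ℕ} (h : q ≤ p) (i : Fin q) : Vec p q :=
  Pi.single (Sum.inl (mir h i)) 1 - Pi.single (Sum.inr i) 1

/-- `hyp h i`, with `i` 1-based, is the hyperplane `Π_i`: `x^{p-i+1} + x^{p+i} = 0` for
`1 ≤ i ≤ q`, and `hyp h 0 = Π_0` is the whole space. -/
def hyp {p q : ℕ} (h : q ≤ p) (i : ℕ) : Set (Vec p q) :=
  {x | ∀ j : Fin q, (j : ℕ) + 1 = i → x (Sum.inl (mir h j)) + x (Sum.inr j) = 0}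

/-- `⋂_{i=0}^{k} Π_i`. -/
def hypInter {p q : ℕ} (h : q ≤ p) (k : ℕ) : Set (Vec p q) := ⋂ i ∈ Set.Iic k, hyp h i

/-- `⋂_{i=0}^{k-1} Π_i \ ⋂_{i=0}^{k} Π_i` (used for `1 ≤ k ≤ q`). -/
def slice {p q : ℕ} (h : q ≤ p) (k : ℕ) : Set (Vec p q) := hypInter h (k - 1) \ hypInter h k

/-- The `p`-dimensional degenerate subspace `W^p = ⋂_{i=1}^q Π_i`. -/
def degSpace {p q : ℕ} (h : q ≤ p) : Set (Vec p q) := hypInter h q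

/-- The subspace spanned by `w_1, …, w_q`. -/
def wSpan {p q : ℕ} (h : q ≤ p) : Submodule ℝ (Vec p q) := Submodule.span ℝ (Set.range (w h))

/-- The half-space `∑_{i<l} ℝ w_i + ℝ_+ w_l`. -/
def wPos {p q : ℕ} (h : q ≤ p) (l : Fin q) : Set (Vec p q) :=
  (Submodule.span ℝ (w h '' Set.Iio l) : Set (Vec p q)) + {v | ∃ t : ℝ, 0 < t ∧ v = t • w h l}

/-- The half-space `∑_{i<l} ℝ w_i + ℝ_- w_l`. -/
def wNeg {p q : ℕ} (h : q ≤ p) (l : Fin q) : Set (Vec p q) :=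
  (Submodule.span ℝ (w h '' Set.Iio l) : Set (Vec p q)) + {v | ∃ t : ℝ, t < 0 ∧ v = t • w h l}

/-- The Euclidean sphere of radius `r` about the origin in `ℝ e_1 ⊕ ⋯ ⊕ ℝ e_{p-q}`. -/
def coreSphere (p q : ℕ) (r : ℝ) : Set (Vec p q) :=
  {y | (∀ i : Fin p, p - q ≤ (i : ℕ) → y (Sum.inl i) = 0) ∧ (∀ j : Fin q, y (Sum.inr j) = 0) ∧
    ∑ i : Fin p, y (Sum.inl i) ^ 2 = r ^ 2}

/-- The cylinder `C^{p-1}_q(r) = S^{p-q-1}(r) × (ℝ w_1 ⊕ ⋯ ⊕ ℝ w_q)`. -/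
def cylinder {p q : ℕ} (h : q ≤ p) (r : ℝ) : Set (Vec p q) :=
  coreSphere p q r + (wSpan h : Set (Vec p q))

/-- The element of `𝔞` with parameters `c_1, …, c_q`: off-diagonal block `C` with the entry `c_j`
in row `p - j + 1` and column `j`, zero elsewhere. -/
def aMat {p q : ℕ} (h : q ≤ p) (c : Fin q → ℝ) : Mat p q :=
  Matrix.fromBlocks 0 (Matrix.of fun i j => if i = mir h j then c j else 0)
    (Matrix.of fun i j => if i = mir h j then c j else 0)ᵀ 0

/-- The maximal abelian subspace `𝔞`. -/
def aSet {p q : ℕ} (h : q ≤ p) : Set (Mat p q) := Set.range (aMat h)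

/-- `𝔨₀ ≅ 𝔰𝔬(p-q)`: the elements of `𝔰𝔬(p,q)` supported in the upper left block of
size `p - q`. -/
def k0Set (p q : ℕ) : Set (Mat p q) :=
  {X | X ∈ LieAlgebra.Orthogonal.so' (Fin p) (Fin q) ℝ ∧
    ∀ a b, X a b ≠ 0 →
      ∃ i j : Fin p, (i : ℕ) < p - q ∧ (j : ℕ) < p - q ∧ a = Sum.inl i ∧ b = Sum.inl j}

/-- The functional `f_i` on `𝔞`, whose value on the matrix with parameters `c` is `-c_i`. -/
def fRoot {q : ℕ} (i : Fin q) : (Fin q → ℝ) →ₗ[ℝ] ℝ := -LinearMap.proj i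

/-- The positive restricted roots: `f_i ± f_j` for `i < j`, and the `f_l`. (For `p = q` the `f_l`
are not roots; the corresponding space `rootSpace` is then zero, so that listing them is
harmless.) -/
def posRoots (q : ℕ) : Set ((Fin q → ℝ) →ₗ[ℝ] ℝ) :=
  {φ | (∃ i j : Fin q, i < j ∧ (φ = fRoot i + fRoot j ∨ φ = fRoot i - fRoot j)) ∨
    ∃ l : Fin q, φ = fRoot l}

/-- The restricted root space of `φ` in `𝔰𝔬(p,q)`. -/
def rootSpace {p q : ℕ} (h : q ≤ p) (φ : (Fin q → ℝ) →ₗ[ℝ] ℝ) : Set (Mat p q) :=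
  {X | X ∈ LieAlgebra.Orthogonal.so' (Fin p) (Fin q) ℝ ∧
    ∀ c : Fin q → ℝ, ⁅aMat h c, X⁆ = φ c • X}

/-- `𝔫`, the sum of the positive restricted root spaces. -/
def nSpace {p q : ℕ} (h : q ≤ p) : Submodule ℝ (Mat p q) :=
  Submodule.span ℝ (⋃ φ ∈ posRoots q, rootSpace h φ)

/-- The ambient general linear group. -/
abbrev GLpq (p q : ℕ) : Type := GL (Fin p ⊕ Fin q) ℝ

/-- The connected Lie subgroup with Lie algebra `s`, that is, the subgroup generated
by `exp s`. -/
def expGroup {p q : ℕ} (s : Set (Mat p q)) : Subgroup (GLpq p q) :=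
  Subgroup.closure {g | ∃ X ∈ s, (g : Mat p q) = NormedSpace.exp X}

/-- The subgroup `K₀ ≅ SO(p-q)`. -/
def K0 (p q : ℕ) : Subgroup (GLpq p q) := expGroup (k0Set p q)

/-- The abelian factor `A = exp 𝔞`. -/
def groupA {p q : ℕ} (h : q ≤ p) : Subgroup (GLpq p q) := expGroup (aSet h)

/-- The nilpotent factor `N = exp 𝔫`. -/
def groupN {p q : ℕ} (h : q ≤ p) : Subgroup (GLpq p q) := expGroup (nSpace h : Set (Mat p q))

/-- The group `K'AN`, as the subgroup generated by its three factors. -/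
def KAN {p q : ℕ} (h : q ≤ p) (K' : Subgroup (GLpq p q)) : Subgroup (GLpq p q) :=
  K' ⊔ groupA h ⊔ groupN h

/-- The orbit of `x` under the natural linear action. -/
def orbit {p q : ℕ} (G : Subgroup (GLpq p q)) (x : Vec p q) : Set (Vec p q) :=
  {y | ∃ g ∈ G, y = (g : Mat p q) *ᵥ x}

/-- The Lie algebra of `G`: the matrices whose one-parameter group lies in `G`. -/
def lieAlg {p q : ℕ} (G : Subgroup (GLpq p q)) : Set (Mat p q) :=
  {X | ∀ t : ℝ, ∃ g ∈ G, (g : Mat p q) = NormedSpace.exp (t • X)}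

/-- The dimension of the orbit of `x`, that is, of its tangent space `{X x | X ∈ Lie G}` at `x`.
(This set is already a subspace, so that the span only serves to form its dimension.) -/
noncomputable def orbitDim {p q : ℕ} (G : Subgroup (GLpq p q)) (x : Vec p q) : ℕ :=
  Module.finrank ℝ (Submodule.span ℝ ((fun X : Mat p q => X *ᵥ x) '' lieAlg G))

/-- The set of the `m`-dimensional orbits of `G` through points of `M`. -/
def orbitsOfDim {p q : ℕ} (G : Subgroup (GLpq p q)) (M : Set (Vec p q)) (m : ℕ) :
    Set (Set (Vec p q)) :=
  {O | ∃ x ∈ M, orbitDim G x = m ∧ O = orbit G x}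

/-- The set of the connected components of `T`. -/
def components {p q : ℕ} (T : Set (Vec p q)) : Set (Set (Vec p q)) :=
  {C | ∃ x ∈ T, C = connectedComponentIn T x}

end KANOrbits

open KANOrbits

/-!
The group `G = K'AN` is understood through null coordinates. With `u_i = x^{p-i+1} + x^{p+i}` and
`v_i = x^{p-i+1} - x^{p+i}` the scalar product is that of the definite part
`ℝ e_1 ⊕ ⋯ ⊕ ℝ e_{p-q}` plus `∑ u_i v_i`, and `𝔞` acts diagonally: `u_i` is multiplied by `c_i`,
`v_i` by `-c_i`, and the definite part is killed.

*Invariants.* All positive roots are positive on the element of `𝔞` with parameters `c_i = i - q`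
(`i` counted from `0`), so `𝔫` strictly raises the degree which this element defines
(`apply_nSpace_eq_zero`). Hence `K_0`, `A` and `N` preserve the flag of the subspaces
`u_1 = ⋯ = u_k = 0` and the flag of the subspaces `ℝ w_1 + ⋯ + ℝ w_l`, together with the
orientations of the successive quotients, and the scalar product: this is
`KAN_le_posTriangularGroup`. So the index and the sign of the first nonzero `u_k` are constant on
an orbit, and on the span of the `w_i` so are those of the last nonzero coefficient.

*Transitivity.* The nilpotent element `b ∧ w_k : x ↦ ⟨w_k, x⟩ b - ⟨b, x⟩ w_k` lies in `𝔫` as soon as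
`u_i(b) = 0` for `i ≤ k` (`wedge_w_mem_nSpace`). Modulo `w_k` its exponential moves `x` to
`x + u_k(x) b`, and the `w_k`-component is then forced by the scalar product. One such element and
one element of `A` therefore join any two points of a level set which have the same first nonzero
null coordinate, up to a positive factor (`orbit_eq_levelPiece`). The elements `b ∧ z_l`, where
`z_l = e_{p-l+1} + e_{p+l}` and `b` is a combination of the `w_i` with `i < l`, do the same in the
span of the `w_i` (`orbit_eq_wPiece`). On the degenerate subspace a point with nonzero definite
part is moved by `N` along all of the span of the `w_i` (`exists_groupN_translation`), and its
definite part is moved by `K'` alone (`orbit_eq_add_wSpan`).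

*Dimensions.* The same elements of the Lie algebra, applied once, show that the orbit tangent space
fills what the invariants allow (`orbitTangent_eq_flagTangent`, `orbitTangent_eq_span_w`).

*Components.* A level set on which `u_1 = ⋯ = u_{k-1} = 0` and `u_k` has a fixed sign is a graph
over a convex set, since `v_k` is determined by the other coordinates. So it is connected, and the
two signs give the two components of the level set in `Σ_m` (`components_levelPiece`).
-/

namespace KANOrbits

/-! ### Matrix exponentials applied to vectors -/

section Exponential

variable {n : Type*} [Fintype n] [DecidableEq n]

open scoped Nat in
/-- The exponential series of a matrix, applied to a vector. -/
theorem hasSum_exp_mulVec (X : Matrix n n ℝ) (x : n → ℝ) :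
    HasSum (fun k : ℕ => (k !⁻¹ : ℝ) • (X ^ k *ᵥ x)) (NormedSpace.exp X *ᵥ x) := by
  -- Any norm compatible with the topology would do.
  let _ : NormedRing (Matrix n n ℝ) := Matrix.linftyOpNormedRing
  let _ : NormedAlgebra ℝ (Matrix n n ℝ) := Matrix.linftyOpNormedAlgebra
  have h := NormedSpace.exp_series_hasSum_exp' (𝕂 := ℝ) X
  have h2 := h.map (Matrix.mulVecBilin ℝ ℝ |>.flip x : Matrix n n ℝ →ₗ[ℝ] n → ℝ)
    (LinearMap.continuous_of_finiteDimensional _)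
  simp only [Function.comp_def, map_smul] at h2
  exact h2

theorem pow_mulVec_mem {X : Matrix n n ℝ} {S : Submodule ℝ (n → ℝ)}
    (hS : ∀ y ∈ S, X *ᵥ y ∈ S) {x : n → ℝ} (hx : x ∈ S) (k : ℕ) : X ^ k *ᵥ x ∈ S := by
  induction k with
  | zero => simpa using hx
  | succ k ih => rw [pow_succ', ← Matrix.mulVec_mulVec]; exact hS _ ih

theorem exp_mulVec_mem {X : Matrix n n ℝ} {S : Submodule ℝ (n → ℝ)}
    (hS : ∀ y ∈ S, X *ᵥ y ∈ S) {x : n → ℝ} (hx : x ∈ S) : NormedSpace.exp X *ᵥ x ∈ S :=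
  S.closed_of_finiteDimensional.mem_of_tendsto (hasSum_exp_mulVec X x)
    (Filter.Eventually.of_forall fun _ =>
      S.sum_mem fun k _ => S.smul_mem _ (pow_mulVec_mem hS hx k))

open scoped Nat in
/-- A functional which is an eigenvector of the transpose of `X` on an invariant subspace is an
eigenvector of the transpose of `exp X` there. -/
theorem apply_exp_mulVec {X : Matrix n n ℝ} {S : Submodule ℝ (n → ℝ)}
    (hS : ∀ y ∈ S, X *ᵥ y ∈ S) (f : (n → ℝ) →ₗ[ℝ] ℝ) (c : ℝ)
    (hf : ∀ y ∈ S, f (X *ᵥ y) = c * f y) {x : n → ℝ} (hx : x ∈ S) :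
    f (NormedSpace.exp X *ᵥ x) = Real.exp c * f x := by
  have h1 := (hasSum_exp_mulVec X x).map f (LinearMap.continuous_of_finiteDimensional f)
  have h2 : HasSum (fun k : ℕ => (k !⁻¹ : ℝ) * c ^ k * f x) (Real.exp c * f x) := by
    have := NormedSpace.exp_series_hasSum_exp' (𝕂 := ℝ) c
    rw [← Real.exp_eq_exp_ℝ] at this
    simpa using this.mul_right (f x)
  refine h1.unique (h2.congr_fun ?_)
  intro k
  have : f (X ^ k *ᵥ x) = c ^ k * f x := by
    induction k with
    | zero => simp
    | succ k ih =>
      rw [pow_succ', ← Matrix.mulVec_mulVec, hf _ (pow_mulVec_mem hS hx k), ih]; ring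
  simp [this, mul_assoc]

/-- The exponential agrees with `1 + X` on a vector, up to an invariant subspace that contains
the second-order term. -/
theorem exp_mulVec_sub_mem {X : Matrix n n ℝ} {S : Submodule ℝ (n → ℝ)}
    (hS : ∀ y ∈ S, X *ᵥ y ∈ S) {x : n → ℝ} (hx : X *ᵥ X *ᵥ x ∈ S) :
    NormedSpace.exp X *ᵥ x - (x + X *ᵥ x) ∈ S := by
  have h := (hasSum_nat_add_iff' 2).2 (hasSum_exp_mulVec X x)
  have e : NormedSpace.exp X *ᵥ x - (x + X *ᵥ x) = NormedSpace.exp X *ᵥ x -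
      ∑ i ∈ Finset.range 2, ((i.factorial : ℝ)⁻¹) • (X ^ i *ᵥ x) := by
    simp [Finset.sum_range_succ]
  rw [e]
  refine S.closed_of_finiteDimensional.mem_of_tendsto h
    (Filter.Eventually.of_forall fun _ => S.sum_mem fun k _ => S.smul_mem _ ?_)
  rw [pow_add, ← Matrix.mulVec_mulVec, pow_two, ← Matrix.mulVec_mulVec]
  exact pow_mulVec_mem hS hx k

theorem exp_mulVec_of_sq_eq_zero {X : Matrix n n ℝ} {x : n → ℝ} (hx : X *ᵥ X *ᵥ x = 0) :
    NormedSpace.exp X *ᵥ x = x + X *ᵥ x := by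
  have := exp_mulVec_sub_mem (X := X) (S := ⊥) (x := x) (by simp) (by simpa using hx)
  exact sub_eq_zero.1 (by simpa using this)

theorem exp_mulVec_of_eq_zero {X : Matrix n n ℝ} {x : n → ℝ} (hx : X *ᵥ x = 0) :
    NormedSpace.exp X *ᵥ x = x := by
  rw [exp_mulVec_of_sq_eq_zero (by simp [hx]), hx, add_zero]

theorem hasDerivAt_exp_mulVec (X : Matrix n n ℝ) (x : n → ℝ) :
    HasDerivAt (fun t : ℝ => NormedSpace.exp (t • X) *ᵥ x) (X *ᵥ x) 0 := by
  let _ : NormedRing (Matrix n n ℝ) := Matrix.linftyOpNormedRing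
  let _ : NormedAlgebra ℝ (Matrix n n ℝ) := Matrix.linftyOpNormedAlgebra
  have h := hasDerivAt_exp_smul_const (𝕂 := ℝ) X 0
  let L : Matrix n n ℝ →L[ℝ] n → ℝ :=
    LinearMap.toContinuousLinearMap (Matrix.mulVecBilin ℝ ℝ |>.flip x)
  have := L.hasFDerivAt.comp_hasDerivAt (0 : ℝ) h
  simp only [zero_smul, NormedSpace.exp_zero, one_mul] at this
  exact this

theorem commute_exp_of_commute {B X : Matrix n n ℝ} (hB : Commute B X) :
    Commute B (NormedSpace.exp X) := by
  let _ : NormedRing (Matrix n n ℝ) := Matrix.linftyOpNormedRing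
  let _ : NormedAlgebra ℝ (Matrix n n ℝ) := Matrix.linftyOpNormedAlgebra
  let _ : NormedAlgebra ℚ (Matrix n n ℝ) := NormedAlgebra.restrictScalars ℚ ℝ _
  exact hB.exp_right

theorem exists_coe_eq_exp (X : Matrix n n ℝ) :
    ∃ g : GL n ℝ, (g : Matrix n n ℝ) = NormedSpace.exp X := Matrix.isUnit_exp X

theorem coe_inv_eq_exp_neg {g : GL n ℝ} {X : Matrix n n ℝ}
    (hg : (g : Matrix n n ℝ) = NormedSpace.exp X) :
    ((g⁻¹ : GL n ℝ) : Matrix n n ℝ) = NormedSpace.exp (-X) := by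
  rw [Matrix.exp_neg, ← hg, Matrix.coe_units_inv]

end Exponential

/-! ### Null coordinates -/

section Coordinates

variable {p q : ℕ}

/-- The null coordinate `x ↦ x^{p-i+1} + x^{p+i}`, whose kernel is the hyperplane `Π_i`. As for `w`,
the index of the Lean function is 0-based. -/
def uCoord (h : q ≤ p) (i : Fin q) : Vec p q →ₗ[ℝ] ℝ :=
  LinearMap.proj (R := ℝ) (φ := fun _ => ℝ) (Sum.inl (mir h i)) + LinearMap.proj (Sum.inr i)

/-- The null coordinate `x ↦ x^{p-i+1} - x^{p+i}`, dual to `w_i` up to a factor `2`. -/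
def vCoord (h : q ≤ p) (i : Fin q) : Vec p q →ₗ[ℝ] ℝ :=
  LinearMap.proj (R := ℝ) (φ := fun _ => ℝ) (Sum.inl (mir h i)) - LinearMap.proj (Sum.inr i)

/-- The null vector `e_{p-i+1} + e_{p+i}` opposite to `w_i`. -/
def zVec (h : q ≤ p) (i : Fin q) : Vec p q :=
  Pi.single (Sum.inl (mir h i)) 1 + Pi.single (Sum.inr i) 1

/-- The projection onto the definite part `ℝ e_1 ⊕ ⋯ ⊕ ℝ e_{p-q}`. -/
def corePart (p q : ℕ) : Vec p q →ₗ[ℝ] Vec p q where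
  toFun x := Sum.elim (fun i => if (i : ℕ) < p - q then x (Sum.inl i) else 0) 0
  map_add' x y := by ext (i | j) <;> simp; split_ifs <;> simp
  map_smul' c x := by ext (i | j) <;> simp

@[simp] theorem corePart_inl (x : Vec p q) (i : Fin p) :
    corePart p q x (Sum.inl i) = if (i : ℕ) < p - q then x (Sum.inl i) else 0 := rfl

@[simp] theorem corePart_inr (x : Vec p q) (j : Fin q) : corePart p q x (Sum.inr j) = 0 := rfl

theorem uCoord_apply (h : q ≤ p) (i : Fin q) (x : Vec p q) :
    uCoord h i x = x (Sum.inl (mir h i)) + x (Sum.inr i) := rfl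

theorem vCoord_apply (h : q ≤ p) (i : Fin q) (x : Vec p q) :
    vCoord h i x = x (Sum.inl (mir h i)) - x (Sum.inr i) := rfl

theorem mir_val (h : q ≤ p) (i : Fin q) : (mir h i : ℕ) = p - 1 - i := by
  simp [mir, Fin.val_rev]; omega

theorem mir_inj (h : q ≤ p) {i j : Fin q} : mir h i = mir h j ↔ i = j := by
  simp [mir]

theorem not_mir_lt (h : q ≤ p) (i : Fin q) : ¬ (mir h i : ℕ) < p - q := by
  rw [mir_val]; omega

theorem exists_mir_eq (h : q ≤ p) {i : Fin p} (hi : ¬ (i : ℕ) < p - q) :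
    ∃ j : Fin q, mir h j = i := by
  refine ⟨⟨p - 1 - i, by omega⟩, Fin.ext ?_⟩
  rw [mir_val]; simp; omega

@[simp] theorem uCoord_w (h : q ≤ p) (i j : Fin q) : uCoord h i (w h j) = 0 := by
  simp [uCoord_apply, w, Pi.single_apply, mir_inj]

@[simp] theorem vCoord_w (h : q ≤ p) (i j : Fin q) :
    vCoord h i (w h j) = if i = j then 2 else 0 := by
  simp [vCoord_apply, w, Pi.single_apply, mir_inj]; split_ifs <;> norm_num

@[simp] theorem uCoord_zVec (h : q ≤ p) (i j : Fin q) :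
    uCoord h i (zVec h j) = if i = j then 2 else 0 := by
  simp [uCoord_apply, zVec, Pi.single_apply, mir_inj]; split_ifs <;> norm_num

@[simp] theorem vCoord_zVec (h : q ≤ p) (i j : Fin q) : vCoord h i (zVec h j) = 0 := by
  simp [vCoord_apply, zVec, Pi.single_apply, mir_inj]

@[simp] theorem corePart_w (h : q ≤ p) (j : Fin q) : corePart p q (w h j) = 0 := by
  ext (i | i) <;> simp [w, Pi.single_apply]
  rintro hi rfl
  exact not_mir_lt h j hi

@[simp] theorem corePart_zVec (h : q ≤ p) (j : Fin q) : corePart p q (zVec h j) = 0 := by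
  ext (i | i) <;> simp [zVec, Pi.single_apply]
  rintro hi rfl
  exact not_mir_lt h j hi

@[simp] theorem uCoord_corePart (h : q ≤ p) (i : Fin q) (x : Vec p q) :
    uCoord h i (corePart p q x) = 0 := by
  simp [uCoord_apply, not_mir_lt]

@[simp] theorem vCoord_corePart (h : q ≤ p) (i : Fin q) (x : Vec p q) :
    vCoord h i (corePart p q x) = 0 := by
  simp [vCoord_apply, not_mir_lt]

@[simp] theorem corePart_corePart (x : Vec p q) :
    corePart p q (corePart p q x) = corePart p q x := by
  ext (i | i)
  · simp only [corePart_inl]; split_ifs <;> rfl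
  · rfl

/-- The null coordinates together with the definite part determine a vector. -/
theorem ext_coord (h : q ≤ p) {x y : Vec p q} (hu : ∀ i, uCoord h i x = uCoord h i y)
    (hv : ∀ i, vCoord h i x = vCoord h i y) (hc : corePart p q x = corePart p q y) : x = y := by
  simp only [uCoord_apply, vCoord_apply] at hu hv
  ext (i | j)
  · by_cases hi : (i : ℕ) < p - q
    · simpa [hi] using congrFun hc (Sum.inl i)
    · obtain ⟨j, rfl⟩ := exists_mir_eq h hi
      linarith [hu j, hv j]
  · linarith [hu j, hv j]

theorem eq_sum_coord (h : q ≤ p) (x : Vec p q) :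
    x = corePart p q x + ∑ j, (vCoord h j x / 2) • w h j + ∑ j, (uCoord h j x / 2) • zVec h j := by
  apply ext_coord h <;> simp

theorem form_add_left (x y a : Vec p q) : form (x + y) a = form x a + form y a := by
  simp [form, add_mul, Finset.sum_add_distrib]; ring

theorem form_smul_left (c : ℝ) (x a : Vec p q) : form (c • x) a = c * form x a := by
  simp [form, mul_assoc, mul_sub, Finset.mul_sum]

theorem form_comm (x y : Vec p q) : form x y = form y x := by
  simp [form, mul_comm]

/-- Pairing with a fixed vector, as a linear functional. -/
def formLeft (a : Vec p q) : Vec p q →ₗ[ℝ] ℝ where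
  toFun x := form a x
  map_add' x y := by rw [form_comm, form_add_left, form_comm x, form_comm y]
  map_smul' c x := by rw [form_comm, form_smul_left, form_comm x]; rfl

@[simp] theorem formLeft_apply (a x : Vec p q) : formLeft a x = form a x := rfl

theorem form_add_right (a x y : Vec p q) : form a (x + y) = form a x + form a y :=
  (formLeft a).map_add x y

theorem form_smul_right (c : ℝ) (a x : Vec p q) : form a (c • x) = c * form a x :=
  (formLeft a).map_smul c x

theorem form_sub_right (a x y : Vec p q) : form a (x - y) = form a x - form a y :=
  (formLeft a).map_sub x y

theorem form_sum_right {ι : Type*} (s : Finset ι) (a : Vec p q) (f : ι → Vec p q) :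
    form a (∑ i ∈ s, f i) = ∑ i ∈ s, form a (f i) :=
  map_sum (formLeft a) f s

theorem form_w_left (h : q ≤ p) (i : Fin q) (x : Vec p q) : form (w h i) x = uCoord h i x := by
  simp [form, w, uCoord_apply, Pi.single_apply, ite_mul]

theorem form_zVec_left (h : q ≤ p) (i : Fin q) (x : Vec p q) :
    form (zVec h i) x = vCoord h i x := by
  simp [form, zVec, vCoord_apply, Pi.single_apply, ite_mul]

theorem form_corePart (x y : Vec p q) :
    form x (corePart p q y) = form (corePart p q x) (corePart p q y) := by
  simp only [form, corePart_inl, corePart_inr, mul_zero, Finset.sum_const_zero]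
  congr 1
  refine Finset.sum_congr rfl fun i _ => ?_
  split_ifs <;> simp

theorem form_eq_sum (h : q ≤ p) (x y : Vec p q) :
    form x y = form (corePart p q x) (corePart p q y) +
      ∑ j, (uCoord h j x * vCoord h j y + vCoord h j x * uCoord h j y) / 2 := by
  conv_lhs => rw [eq_sum_coord h y]
  simp only [form_add_right, form_sum_right, form_smul_right, form_corePart x y]
  rw [add_assoc, ← Finset.sum_add_distrib]
  congr 1
  refine Finset.sum_congr rfl fun j _ => ?_
  rw [form_comm x, form_comm x, form_w_left, form_zVec_left]; ring

theorem form_corePart_self (x : Vec p q) :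
    form (corePart p q x) (corePart p q x) =
      ∑ i : Fin p, if (i : ℕ) < p - q then x (Sum.inl i) ^ 2 else 0 := by
  simp [form]
  refine Finset.sum_congr rfl fun i _ => ?_
  split_ifs <;> ring

theorem form_corePart_self_pos {x : Vec p q} (hx : corePart p q x ≠ 0) :
    0 < form (corePart p q x) (corePart p q x) := by
  rw [form_corePart_self]
  refine Finset.sum_pos' (fun i _ => by positivity) ?_
  by_contra! hc
  apply hx
  ext (i | i) <;> simp
  intro hi
  have := hc i (Finset.mem_univ _)
  rw [if_pos hi] at this
  nlinarith [sq_nonneg (x (Sum.inl i))]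

/-- On the degenerate subspace the scalar product only sees the definite part. -/
theorem form_self_of_uCoord_eq_zero (h : q ≤ p) {x : Vec p q} (hx : ∀ i, uCoord h i x = 0) :
    form x x = form (corePart p q x) (corePart p q x) := by
  rw [form_eq_sum h]; simp [hx]

theorem mem_hypInter_iff (h : q ≤ p) (k : ℕ) (x : Vec p q) :
    x ∈ hypInter h k ↔ ∀ i : Fin q, (i : ℕ) < k → uCoord h i x = 0 := by
  simp only [hypInter, hyp, Set.mem_iInter, Set.mem_Iic, Set.mem_ofPred_eq, uCoord_apply]
  constructor
  · exact fun H i hi => H (i + 1) hi i rfl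
  · rintro H _ hi j rfl
    exact H j hi

theorem mem_slice_iff (h : q ≤ p) (k : Fin q) (x : Vec p q) :
    x ∈ slice h (k + 1) ↔ (∀ i < k, uCoord h i x = 0) ∧ uCoord h k x ≠ 0 := by
  simp only [slice, Set.mem_sdiff, mem_hypInter_iff, Nat.add_sub_cancel]
  refine and_congr_right fun H => not_congr ⟨fun hk => hk k (by omega), fun hk i hi => ?_⟩
  rcases (Nat.lt_succ_iff.1 hi).lt_or_eq with hi | hi
  · exact H i hi
  · rwa [Fin.ext hi]

theorem mem_degSpace_iff (h : q ≤ p) (x : Vec p q) :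
    x ∈ degSpace h ↔ ∀ i, uCoord h i x = 0 := by
  rw [degSpace, mem_hypInter_iff]
  exact forall_congr' fun i => by simp

theorem mem_span_w_iff (h : q ≤ p) (S : Set (Fin q)) (x : Vec p q) :
    x ∈ Submodule.span ℝ (w h '' S) ↔
      (∀ i, uCoord h i x = 0) ∧ corePart p q x = 0 ∧ ∀ i ∉ S, vCoord h i x = 0 := by
  constructor
  · intro hx
    induction hx using Submodule.span_induction with
    | mem x hx =>
      obtain ⟨j, hj, rfl⟩ := hx
      refine ⟨by simp, by simp, fun i hi => ?_⟩
      rw [vCoord_w, if_neg (by rintro rfl; exact hi hj)]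
    | zero => simp
    | add x y _ _ hx hy =>
      refine ⟨fun i => by simp [hx.1, hy.1], by simp [hx.2.1, hy.2.1], fun i hi => ?_⟩
      simp [hx.2.2 i hi, hy.2.2 i hi]
    | smul c x _ hx =>
      refine ⟨fun i => by simp [hx.1], by simp [hx.2.1], fun i hi => by simp [hx.2.2 i hi]⟩
  · rintro ⟨hu, hc, hv⟩
    rw [eq_sum_coord h x]
    simp only [hc, hu, zero_div, zero_smul, Finset.sum_const_zero, zero_add, add_zero]
    refine Submodule.sum_mem _ fun j _ => ?_
    by_cases hj : j ∈ S
    · exact Submodule.smul_mem _ _ (Submodule.subset_span ⟨j, hj, rfl⟩)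
    · simp [hv j hj]

theorem mem_wSpan_iff (h : q ≤ p) (x : Vec p q) :
    x ∈ wSpan h ↔ (∀ i, uCoord h i x = 0) ∧ corePart p q x = 0 := by
  rw [wSpan, ← Set.image_univ, mem_span_w_iff]; simp

theorem linearIndependent_w (h : q ≤ p) : LinearIndependent ℝ (w h) := by
  rw [Fintype.linearIndependent_iff]
  intro c hc i
  simpa using congrArg (vCoord h i) hc

theorem finrank_span_w_Iic (h : q ≤ p) (l : Fin q) :
    Module.finrank ℝ (Submodule.span ℝ (w h '' Set.Iic l)) = l + 1 := by
  have := finrank_span_eq_card (R := ℝ)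
    ((linearIndependent_w h).comp (fun i : Set.Iic l => (i : Fin q)) Subtype.val_injective)
  rw [Set.range_comp, Subtype.range_coe] at this
  rw [this]; simp

theorem finrank_wSpan (h : q ≤ p) : Module.finrank ℝ (wSpan h) = q := by
  rw [wSpan, finrank_span_eq_card (linearIndependent_w h), Fintype.card_fin]

/-- The tangent space at `x` of the level set of the scalar product in the common kernel of the null
coordinates of index less than `k`. -/
def flagTangent (h : q ≤ p) (k : ℕ) (x : Vec p q) : Submodule ℝ (Vec p q) where
  carrier := {y | (∀ i : Fin q, (i : ℕ) < k → uCoord h i y = 0) ∧ form x y = 0}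
  add_mem' := by
    rintro a b ⟨ha, ha'⟩ ⟨hb, hb'⟩
    exact ⟨fun i hi => by simp [ha i hi, hb i hi], by simp [form_add_right, ha', hb']⟩
  zero_mem' := ⟨by simp, (formLeft x).map_zero⟩
  smul_mem' := by
    rintro c a ⟨ha, ha'⟩
    exact ⟨fun i hi => by simp [ha i hi], by simp [form_smul_right, ha']⟩

theorem mem_flagTangent {h : q ≤ p} {k : ℕ} {x y : Vec p q} : y ∈ flagTangent h k x ↔
    (∀ i : Fin q, (i : ℕ) < k → uCoord h i y = 0) ∧ form x y = 0 := Iff.rfl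

/-- The tangent space has codimension `k + 1` as soon as `x` is not orthogonal to the common
kernel of the null coordinates of index less than `k`. -/
theorem finrank_flagTangent (h : q ≤ p) (k : ℕ) (hk : k ≤ q) (x b : Vec p q)
    (hb : ∀ i : Fin q, (i : ℕ) < k → uCoord h i b = 0) (hbx : form x b ≠ 0) :
    Module.finrank ℝ (flagTangent h k x) + (k + 1) = p + q := by
  let e : Fin k → Fin q := Fin.castLE hk
  let F : Vec p q →ₗ[ℝ] (Fin k → ℝ) × ℝ :=
    (LinearMap.pi fun i => uCoord h (e i)).prod (formLeft x)
  have hker : LinearMap.ker F = flagTangent h k x := by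
    ext y
    rw [LinearMap.mem_ker, mem_flagTangent]
    change ((fun i => uCoord h (e i) y), form x y) = (0, 0) ↔ _
    rw [Prod.mk_inj]
    refine and_congr ⟨fun H i hi => ?_, fun H => ?_⟩ Iff.rfl
    · exact congrFun H ⟨i, hi⟩
    · ext i
      exact H (e i) i.2
  have hsurj : Function.Surjective F := by
    rintro ⟨f, s⟩
    let y : Vec p q := ∑ i : Fin k, (f i / 2) • zVec h (e i)
    refine ⟨y + ((s - form x y) / form x b) • b, ?_⟩
    have hy : ∀ j, uCoord h (e j) y = f j := by
      intro j
      have : ∀ i, e j = e i ↔ j = i := fun i => (Fin.castLE_injective hk).eq_iff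
      simp [y, this]
    have e1 : (fun i => uCoord h (e i) (y + ((s - form x y) / form x b) • b)) = f := by
      ext i
      simp [hy, hb (e i) i.2]
    refine Prod.ext e1 ?_
    change form x (y + ((s - form x y) / form x b) • b) = s
    rw [form_add_right, form_smul_right]
    field_simp
    ring
  have := F.finrank_range_add_finrank_ker
  rw [hker, LinearMap.range_eq_top.2 hsurj, finrank_top] at this
  simp only [Module.finrank_prod, Module.finrank_self,
    Module.finrank_fintype_fun_eq_card, Fintype.card_sum, Fintype.card_fin] at this
  omega

end Coordinates

/-! ### The subalgebras `𝔞`, `𝔫` and `𝔨₀` in null coordinates -/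

section LieAlgebra

variable {p q : ℕ}

theorem form_eq_dotProduct (x y : Vec p q) :
    form x y = x ⬝ᵥ (LieAlgebra.Orthogonal.indefiniteDiagonal (Fin p) (Fin q) ℝ *ᵥ y) := by
  simp [form, LieAlgebra.Orthogonal.indefiniteDiagonal, Matrix.mulVec_diagonal, dotProduct,
    sub_eq_add_neg]

theorem mem_so'_iff {X : Mat p q} : X ∈ LieAlgebra.Orthogonal.so' (Fin p) (Fin q) ℝ ↔
    ∀ x y, form (X *ᵥ x) y = -form x (X *ᵥ y) := by
  have key : X ∈ LieAlgebra.Orthogonal.so' (Fin p) (Fin q) ℝ ↔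
      Xᵀ * LieAlgebra.Orthogonal.indefiniteDiagonal (Fin p) (Fin q) ℝ =
        LieAlgebra.Orthogonal.indefiniteDiagonal (Fin p) (Fin q) ℝ * (-X) := by
    rw [LieAlgebra.Orthogonal.so', mem_skewAdjointMatricesLieSubalgebra,
      mem_skewAdjointMatricesSubmodule]
    rfl
  have h1 : ∀ x y, form (X *ᵥ x) y =
      x ⬝ᵥ ((Xᵀ * LieAlgebra.Orthogonal.indefiniteDiagonal (Fin p) (Fin q) ℝ) *ᵥ y) := by
    intro x y
    rw [form_eq_dotProduct, ← Matrix.mulVec_mulVec, Matrix.dotProduct_mulVec x,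
      Matrix.vecMul_transpose]
  have h2 : ∀ x y, -form x (X *ᵥ y) =
      x ⬝ᵥ ((LieAlgebra.Orthogonal.indefiniteDiagonal (Fin p) (Fin q) ℝ * (-X)) *ᵥ y) := by
    intro x y
    rw [form_eq_dotProduct, ← Matrix.mulVec_mulVec, Matrix.neg_mulVec, Matrix.mulVec_neg,
      dotProduct_neg]
  rw [key]
  constructor
  · intro H x y
    rw [h1, h2, H]
  · intro H
    ext i j
    have := H (Pi.single i 1) (Pi.single j 1)
    rw [h1, h2] at this
    simpa using this

theorem form_exp_mulVec_left {X : Mat p q} (hX : ∀ x y, form (X *ᵥ x) y = -form x (X *ᵥ y))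
    (x y : Vec p q) : form (NormedSpace.exp X *ᵥ x) y = form x (NormedSpace.exp (-X) *ᵥ y) := by
  have h1 := (hasSum_exp_mulVec X x).map (formLeft y)
    (LinearMap.continuous_of_finiteDimensional _)
  have h2 := (hasSum_exp_mulVec (-X) y).map (formLeft x)
    (LinearMap.continuous_of_finiteDimensional _)
  simp only [formLeft_apply, form_comm y] at h1
  refine h1.unique (h2.congr_fun fun k => ?_)
  have : ∀ y, form (X ^ k *ᵥ x) y = form x ((-X) ^ k *ᵥ y) := by
    induction k with
    | zero => simp
    | succ k ih =>
      intro y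
      rw [pow_succ', ← Matrix.mulVec_mulVec, hX, ih, pow_succ, ← Matrix.mulVec_mulVec,
        Matrix.neg_mulVec, Matrix.mulVec_neg]
      exact ((formLeft x).map_neg _).symm
  simp [this, form_comm y]

theorem form_exp_mulVec {X : Mat p q} (hX : ∀ x y, form (X *ᵥ x) y = -form x (X *ᵥ y))
    (x y : Vec p q) : form (NormedSpace.exp X *ᵥ x) (NormedSpace.exp X *ᵥ y) = form x y := by
  obtain ⟨g, hg⟩ := exists_coe_eq_exp X
  rw [form_exp_mulVec_left hX, ← coe_inv_eq_exp_neg hg, ← hg, Matrix.mulVec_mulVec,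
    Units.inv_mul, Matrix.one_mulVec]

theorem aMat_mulVec_inl (h : q ≤ p) (c : Fin q → ℝ) (x : Vec p q) (j : Fin q) :
    (aMat h c *ᵥ x) (Sum.inl (mir h j)) = c j * x (Sum.inr j) := by
  simp [aMat, Matrix.mulVec, dotProduct, mir_inj]

theorem aMat_mulVec_inr (h : q ≤ p) (c : Fin q → ℝ) (x : Vec p q) (j : Fin q) :
    (aMat h c *ᵥ x) (Sum.inr j) = c j * x (Sum.inl (mir h j)) := by
  simp [aMat, Matrix.mulVec, dotProduct]

@[simp] theorem uCoord_aMat (h : q ≤ p) (c : Fin q → ℝ) (x : Vec p q) (j : Fin q) :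
    uCoord h j (aMat h c *ᵥ x) = c j * uCoord h j x := by
  rw [uCoord_apply, aMat_mulVec_inl, aMat_mulVec_inr, uCoord_apply]; ring

@[simp] theorem vCoord_aMat (h : q ≤ p) (c : Fin q → ℝ) (x : Vec p q) (j : Fin q) :
    vCoord h j (aMat h c *ᵥ x) = -c j * vCoord h j x := by
  rw [vCoord_apply, aMat_mulVec_inl, aMat_mulVec_inr, vCoord_apply]; ring

@[simp] theorem corePart_aMat (h : q ≤ p) (c : Fin q → ℝ) (x : Vec p q) :
    corePart p q (aMat h c *ᵥ x) = 0 := by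
  ext (i | i)
  · simp only [corePart_inl, Pi.zero_apply, ite_eq_right_iff]
    intro hi
    have : ∀ j, i ≠ mir h j := by rintro j rfl; exact not_mir_lt h j hi
    simp [aMat, Matrix.mulVec, dotProduct, this]
  · rfl

theorem aMat_mulVec_w (h : q ≤ p) (c : Fin q → ℝ) (j : Fin q) :
    aMat h c *ᵥ w h j = fRoot j c • w h j := by
  apply ext_coord h <;> simp [fRoot]
  intro i
  split_ifs with hi <;> simp [hi]

theorem aMat_mulVec_zVec (h : q ≤ p) (c : Fin q → ℝ) (j : Fin q) :
    aMat h c *ᵥ zVec h j = (-fRoot j) c • zVec h j := by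
  apply ext_coord h <;> simp [fRoot]
  intro i
  split_ifs with hi <;> simp [hi]

theorem aMat_mulVec_corePart (h : q ≤ p) (c : Fin q → ℝ) (x : Vec p q) :
    aMat h c *ᵥ corePart p q x = 0 := by
  apply ext_coord h <;> simp

theorem form_aMat (h : q ≤ p) (c : Fin q → ℝ) (x y : Vec p q) :
    form (aMat h c *ᵥ x) y = -form x (aMat h c *ᵥ y) := by
  rw [form_eq_sum h, form_eq_sum h x]
  simp only [corePart_aMat, uCoord_aMat, vCoord_aMat]
  have h0 : ∀ y : Vec p q, form 0 y = 0 := fun y => by simp [form]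
  rw [h0, form_comm _ 0, h0, zero_add, zero_add, ← Finset.sum_neg_distrib]
  exact Finset.sum_congr rfl fun j _ => by ring

theorem k0_mulVec {Y : Mat p q} (hY : Y ∈ k0Set p q) (x : Vec p q) :
    corePart p q (Y *ᵥ x) = Y *ᵥ x := by
  ext (i | j)
  · rw [corePart_inl, ite_eq_left_iff]
    intro hi
    change 0 = ∑ b, Y (Sum.inl i) b * x b
    refine (Finset.sum_eq_zero fun b _ => ?_).symm
    by_contra hb
    obtain ⟨i', j', hi', hj', h1, h2⟩ := hY.2 _ _ (left_ne_zero_of_mul hb)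
    exact hi (by rwa [Sum.inl_injective h1])
  · change 0 = ∑ b, Y (Sum.inr j) b * x b
    refine (Finset.sum_eq_zero fun b _ => ?_).symm
    by_contra hb
    obtain ⟨i', j', hi', hj', h1, h2⟩ := hY.2 _ _ (left_ne_zero_of_mul hb)
    cases h1

theorem k0_mulVec_eq_zero {Y : Mat p q} (hY : Y ∈ k0Set p q) {x : Vec p q}
    (hx : corePart p q x = 0) : Y *ᵥ x = 0 := by
  ext a
  change ∑ b, Y a b * x b = 0
  refine Finset.sum_eq_zero fun b _ => ?_
  by_contra hb
  obtain ⟨i', j', hi', hj', h1, rfl⟩ := hY.2 _ _ (left_ne_zero_of_mul hb)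
  have := congrFun hx (Sum.inl j')
  rw [corePart_inl, if_pos hj'] at this
  exact right_ne_zero_of_mul hb this

theorem uCoord_k0 (h : q ≤ p) {Y : Mat p q} (hY : Y ∈ k0Set p q) (x : Vec p q) (i : Fin q) :
    uCoord h i (Y *ᵥ x) = 0 := by
  rw [← k0_mulVec hY, uCoord_corePart]

theorem vCoord_k0 (h : q ≤ p) {Y : Mat p q} (hY : Y ∈ k0Set p q) (x : Vec p q) (i : Fin q) :
    vCoord h i (Y *ᵥ x) = 0 := by
  rw [← k0_mulVec hY, vCoord_corePart]

/-- The parameters of a grading element of `𝔞`: all positive restricted roots are positive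
on it. -/
def gradingParam (q : ℕ) (i : Fin q) : ℝ := (i : ℝ) - q

theorem posRoots_gradingParam_pos {φ : (Fin q → ℝ) →ₗ[ℝ] ℝ} (hφ : φ ∈ posRoots q) :
    0 < φ (gradingParam q) := by
  have hlt : ∀ i : Fin q, (i : ℝ) < q := fun i => by exact_mod_cast i.2
  rcases hφ with ⟨i, j, hij, rfl | rfl⟩ | ⟨l, rfl⟩
  · simp [fRoot, gradingParam]; linarith [hlt i, hlt j]
  · have : (i : ℝ) < j := by exact_mod_cast hij
    simp [fRoot, gradingParam, this]
  · simp [fRoot, gradingParam]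

/-- Elements of `𝔫` strictly raise the degree with respect to the grading element. -/
theorem apply_nSpace_eq_zero (h : q ≤ p) {X : Mat p q} (hX : X ∈ nSpace h)
    (f : Vec p q →ₗ[ℝ] ℝ) (μ : ℝ) (hf : ∀ x, f (aMat h (gradingParam q) *ᵥ x) = μ * f x)
    {y : Vec p q} {ν : ℝ} (hy : aMat h (gradingParam q) *ᵥ y = ν • y) (hle : μ ≤ ν) :
    f (X *ᵥ y) = 0 := by
  induction hX using Submodule.span_induction with
  | mem X hX =>
    simp only [Set.mem_iUnion] at hX
    obtain ⟨φ, hφ, hX⟩ := hX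
    have e := congrArg (fun B : Mat p q => f (B *ᵥ y)) (hX.2 (gradingParam q))
    simp only [Ring.lie_def, Matrix.sub_mulVec, ← Matrix.mulVec_mulVec, map_sub, hf, hy,
      Matrix.mulVec_smul, Matrix.smul_mulVec, map_smul, smul_eq_mul] at e
    have hpos := posRoots_gradingParam_pos hφ
    have : (φ (gradingParam q) + ν - μ) * f (X *ᵥ y) = 0 := by linarith
    exact (mul_eq_zero.1 this).resolve_left (by linarith)
  | zero => simp
  | add X Y _ _ hX hY => rw [Matrix.add_mulVec, map_add, hX, hY, add_zero]
  | smul c X _ hX => rw [Matrix.smul_mulVec, map_smul, hX, smul_zero]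

theorem uCoord_nSpace (h : q ≤ p) {X : Mat p q} (hX : X ∈ nSpace h) {k : Fin q} {x : Vec p q}
    (hx : ∀ i < k, uCoord h i x = 0) : uCoord h k (X *ᵥ x) = 0 := by
  have hlt : ∀ i : Fin q, (i : ℝ) < q := fun i => by exact_mod_cast i.2
  have key := fun {y : Vec p q} {ν : ℝ} => apply_nSpace_eq_zero h hX (uCoord h k)
    (gradingParam q k) (fun x => uCoord_aMat h _ x k) (y := y) (ν := ν)
  rw [eq_sum_coord h x]
  simp only [Matrix.mulVec_add, Matrix.mulVec_sum, Matrix.mulVec_smul, map_add, map_sum, map_smul]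
  rw [key (ν := 0) (by rw [aMat_mulVec_corePart, zero_smul])
    (by simp [gradingParam, (hlt k).le]), zero_add, Finset.sum_eq_zero, Finset.sum_eq_zero,
    add_zero]
  · intro j _
    by_cases hj : j < k
    · simp [hx j hj]
    · rw [key (aMat_mulVec_zVec h _ j), smul_zero]
      simpa [fRoot, gradingParam] using hj
  · intro j _
    rw [key (aMat_mulVec_w h _ j), smul_zero]
    simp [fRoot, gradingParam]
    linarith [hlt k, hlt j]

theorem corePart_nSpace (h : q ≤ p) {X : Mat p q} (hX : X ∈ nSpace h) {x : Vec p q}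
    (hx : ∀ i, uCoord h i x = 0) : corePart p q (X *ᵥ x) = 0 := by
  have hlt : ∀ i : Fin q, (i : ℝ) < q := fun i => by exact_mod_cast i.2
  ext a
  have key := fun {y : Vec p q} {ν : ℝ} => apply_nSpace_eq_zero h hX
    (LinearMap.proj (R := ℝ) (φ := fun _ => ℝ) a ∘ₗ corePart p q)
    0 (fun x => by simp) (y := y) (ν := ν)
  change (LinearMap.proj (R := ℝ) (φ := fun _ => ℝ) a ∘ₗ corePart p q) (X *ᵥ x) = 0
  rw [eq_sum_coord h x]
  simp only [hx, zero_div, zero_smul, Finset.sum_const_zero, add_zero]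
  rw [Matrix.mulVec_add, map_add, key (ν := 0) (by rw [aMat_mulVec_corePart, zero_smul]) le_rfl,
    zero_add, Matrix.mulVec_sum, map_sum]
  refine Finset.sum_eq_zero fun j _ => ?_
  rw [Matrix.mulVec_smul, map_smul, key (aMat_mulVec_w h _ j), smul_zero]
  simp [fRoot, gradingParam, (hlt j).le]

theorem nSpace_mulVec_mem_span_w (h : q ≤ p) {X : Mat p q} (hX : X ∈ nSpace h) {l : Fin q}
    {x : Vec p q} (hx : x ∈ Submodule.span ℝ (w h '' Set.Iic l)) :
    X *ᵥ x ∈ Submodule.span ℝ (w h '' Set.Iio l) := by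
  obtain ⟨hu, hc, hv⟩ := (mem_span_w_iff h _ _).1 hx
  refine (mem_span_w_iff h _ _).2 ⟨fun i => uCoord_nSpace h hX fun j _ => hu j,
    corePart_nSpace h hX hu, fun i hi => ?_⟩
  rw [eq_sum_coord h x]
  simp only [hc, hu, zero_div, zero_smul, Finset.sum_const_zero, zero_add, add_zero]
  rw [Matrix.mulVec_sum, map_sum]
  refine Finset.sum_eq_zero fun j _ => ?_
  by_cases hj : j ∈ Set.Iic l
  · rw [Matrix.mulVec_smul, map_smul, apply_nSpace_eq_zero h hX (vCoord h i) (-gradingParam q i)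
      (fun x => vCoord_aMat h _ x i) (aMat_mulVec_w h _ j), smul_zero]
    have : (j : ℝ) ≤ i := by
      exact_mod_cast (Set.mem_Iic.1 hj).trans (not_lt.1 hi)
    simp [fRoot, gradingParam]
    linarith
  · simp [hv j hj]

/-- The infinitesimal isometry `a ∧ b`. -/
noncomputable def wedge (a b : Vec p q) : Mat p q :=
  LinearMap.toMatrix' ((formLeft b).smulRight a - (formLeft a).smulRight b)

@[simp] theorem wedge_mulVec (a b x : Vec p q) :
    wedge a b *ᵥ x = form b x • a - form a x • b := by
  rw [wedge, ← Matrix.toLin'_apply, Matrix.toLin'_toMatrix']; simp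

theorem mat_ext {B C : Mat p q} (H : ∀ x, B *ᵥ x = C *ᵥ x) : B = C :=
  Matrix.mulVec_injective (funext H)

theorem wedge_mem_nSpace (h : q ≤ p) {a b : Vec p q} {α β : (Fin q → ℝ) →ₗ[ℝ] ℝ}
    (ha : ∀ c, aMat h c *ᵥ a = α c • a) (hb : ∀ c, aMat h c *ᵥ b = β c • b)
    (hαβ : α + β ∈ posRoots q) : wedge a b ∈ nSpace h := by
  refine Submodule.subset_span (Set.mem_biUnion hαβ ⟨mem_so'_iff.2 fun x y => ?_, fun c => ?_⟩)
  · simp only [wedge_mulVec, form_sub_right, form_smul_right, form_comm _ y]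
    rw [form_comm x a, form_comm x b]
    ring
  · refine mat_ext fun x => ?_
    have e : ∀ a : Vec p q, form a (aMat h c *ᵥ x) = -form (aMat h c *ᵥ a) x := fun a => by
      rw [form_aMat, neg_neg]
    simp only [Ring.lie_def, Matrix.sub_mulVec, ← Matrix.mulVec_mulVec, wedge_mulVec, e, ha, hb,
      Matrix.mulVec_sub, Matrix.mulVec_smul, Matrix.smul_mulVec, form_smul_left,
      LinearMap.add_apply]
    module

/-- `wedge`, as a linear map in its first argument. -/
noncomputable def wedgeWith (b : Vec p q) : Vec p q →ₗ[ℝ] Mat p q where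
  toFun a := wedge a b
  map_add' x y := mat_ext fun t => by
    simp only [wedge_mulVec, Matrix.add_mulVec, form_add_left]; module
  map_smul' c x := mat_ext fun t => by
    simp only [wedge_mulVec, Matrix.smul_mulVec, form_smul_left, RingHom.id_apply]; module

/-- The Siegel-type nilpotent elements attached to the null vector `w_k` lie in `𝔫`. -/
theorem wedge_w_mem_nSpace (h : q ≤ p) (k : Fin q) {a : Vec p q}
    (ha : ∀ i ≤ k, uCoord h i a = 0) : wedge a (w h k) ∈ nSpace h := by
  change wedgeWith (w h k) a ∈ nSpace h
  rw [eq_sum_coord h a, map_add, map_add, map_sum, map_sum]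
  refine add_mem (add_mem ?_ (sum_mem fun j _ => ?_)) (sum_mem fun j _ => ?_)
  · refine wedge_mem_nSpace h (α := 0) (fun c => ?_) (fun c => aMat_mulVec_w h c k)
      (Or.inr ⟨k, zero_add _⟩)
    rw [aMat_mulVec_corePart]; simp
  · rw [map_smul]
    refine Submodule.smul_mem _ _ ?_
    rcases lt_trichotomy j k with hjk | rfl | hjk
    · exact wedge_mem_nSpace h (fun c => aMat_mulVec_w h c j) (fun c => aMat_mulVec_w h c k)
        (Or.inl ⟨j, k, hjk, Or.inl rfl⟩)
    · have : wedgeWith (w h j) (w h j) = 0 := mat_ext fun x => by simp [wedgeWith]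
      rw [this]; exact zero_mem _
    · exact wedge_mem_nSpace h (fun c => aMat_mulVec_w h c j) (fun c => aMat_mulVec_w h c k)
        (Or.inl ⟨k, j, hjk, Or.inl (add_comm _ _)⟩)
  · by_cases hj : j ≤ k
    · simp [ha j hj]
    · rw [map_smul]
      refine Submodule.smul_mem _ _ ?_
      exact wedge_mem_nSpace h (fun c => aMat_mulVec_zVec h c j) (fun c => aMat_mulVec_w h c k)
        (Or.inl ⟨k, j, not_le.1 hj, Or.inr (by abel)⟩)

end LieAlgebra

/-! ### The group `K'AN` -/

section GroupStructure

variable {p q : ℕ}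

theorem exists_mem_expGroup {s : Set (Mat p q)} {X : Mat p q} (hX : X ∈ s) :
    ∃ g ∈ expGroup s, (g : Mat p q) = NormedSpace.exp X := by
  obtain ⟨g, hg⟩ := exists_coe_eq_exp X
  exact ⟨g, Subgroup.subset_closure ⟨X, hX, hg⟩, hg⟩

theorem inv_mulVec_mulVec (g : GLpq p q) (x : Vec p q) :
    ((g⁻¹ : GLpq p q) : Mat p q) *ᵥ (g : Mat p q) *ᵥ x = x := by
  rw [Matrix.mulVec_mulVec, Units.inv_mul, Matrix.one_mulVec]

theorem mulVec_inv_mulVec (g : GLpq p q) (x : Vec p q) :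
    (g : Mat p q) *ᵥ ((g⁻¹ : GLpq p q) : Mat p q) *ᵥ x = x := by
  rw [Matrix.mulVec_mulVec, Units.mul_inv, Matrix.one_mulVec]

/-- The linear isometries which commute with `𝔞`. -/
def aCentralizer (h : q ≤ p) : Subgroup (GLpq p q) where
  carrier := {g | (∀ c, Commute (aMat h c) (g : Mat p q)) ∧
    ∀ x y, form ((g : Mat p q) *ᵥ x) ((g : Mat p q) *ᵥ y) = form x y}
  mul_mem' := by
    rintro a b ⟨ha, ha'⟩ ⟨hb, hb'⟩
    refine ⟨fun c => (ha c).mul_right (hb c), fun x y => ?_⟩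
    simp only [Units.val_mul, ← Matrix.mulVec_mulVec, ha', hb']
  one_mem' := ⟨fun c => Commute.one_right _, fun x y => by simp⟩
  inv_mem' := by
    rintro a ⟨ha, ha'⟩
    refine ⟨fun c => (ha c).units_inv_right, fun x y => ?_⟩
    rw [← ha', mulVec_inv_mulVec, mulVec_inv_mulVec]

theorem aMat_commute (h : q ≤ p) (c d : Fin q → ℝ) : Commute (aMat h c) (aMat h d) := by
  refine mat_ext fun x => ?_
  rw [← Matrix.mulVec_mulVec, ← Matrix.mulVec_mulVec]
  refine ext_coord h (fun i => ?_) (fun i => ?_) ?_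
  · simp only [uCoord_aMat]; ring
  · simp only [vCoord_aMat]; ring
  · simp only [corePart_aMat]

theorem aMat_commute_k0 (h : q ≤ p) (c : Fin q → ℝ) {Y : Mat p q} (hY : Y ∈ k0Set p q) :
    Commute (aMat h c) Y := by
  refine mat_ext fun x => ?_
  rw [← Matrix.mulVec_mulVec, ← Matrix.mulVec_mulVec,
    k0_mulVec_eq_zero hY (corePart_aMat h c x), ← k0_mulVec hY, aMat_mulVec_corePart]

theorem groupA_le_aCentralizer (h : q ≤ p) : groupA h ≤ aCentralizer h := by
  refine (Subgroup.closure_le _).2 ?_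
  rintro g ⟨_, ⟨d, rfl⟩, hg⟩
  refine ⟨fun c => ?_, fun x y => ?_⟩
  · rw [hg]; exact commute_exp_of_commute (aMat_commute h c d)
  · rw [hg]; exact form_exp_mulVec (form_aMat h d) x y

theorem K0_le_aCentralizer (h : q ≤ p) : K0 p q ≤ aCentralizer h := by
  refine (Subgroup.closure_le _).2 ?_
  rintro g ⟨Y, hY, hg⟩
  refine ⟨fun c => ?_, fun x y => ?_⟩
  · rw [hg]; exact commute_exp_of_commute (aMat_commute_k0 h c hY)
  · rw [hg]; exact form_exp_mulVec (mem_so'_iff.1 hY.1) x y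

theorem aCentralizer_commute_groupA (h : q ≤ p) {g a : GLpq p q} (hg : g ∈ aCentralizer h)
    (ha : a ∈ groupA h) : Commute g a := by
  induction ha using Subgroup.closure_induction with
  | mem a ha =>
    obtain ⟨_, ⟨c, rfl⟩, ha⟩ := ha
    refine Units.ext ?_
    rw [Units.val_mul, Units.val_mul, ha]
    exact commute_exp_of_commute (hg.1 c).symm
  | one => exact Commute.one_right _
  | mul a b _ _ ha hb => exact ha.mul_right hb
  | inv a _ ha => exact ha.inv_right

theorem conj_mem_nSpace (h : q ≤ p) {g : GLpq p q} (hg : g ∈ aCentralizer h) {X : Mat p q}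
    (hX : X ∈ nSpace h) :
    (g : Mat p q) * X * ((g⁻¹ : GLpq p q) : Mat p q) ∈ nSpace h := by
  induction hX using Submodule.span_induction with
  | mem X hX =>
    simp only [Set.mem_iUnion] at hX
    obtain ⟨φ, hφ, hX⟩ := hX
    refine Submodule.subset_span (Set.mem_biUnion hφ ⟨mem_so'_iff.2 fun x y => ?_, fun c => ?_⟩)
    · simp only [← Matrix.mulVec_mulVec]
      rw [← (inv_mem hg).2, inv_mulVec_mulVec, mem_so'_iff.1 hX.1, ← hg.2, mulVec_inv_mulVec]
    · have e1 := hg.1 c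
      have e2 := (inv_mem hg).1 c
      have e3 := hX.2 c
      rw [Ring.lie_def] at e3 ⊢
      calc aMat h c * ((g : Mat p q) * X * ((g⁻¹ : GLpq p q) : Mat p q)) -
            (g : Mat p q) * X * ((g⁻¹ : GLpq p q) : Mat p q) * aMat h c
          = (g : Mat p q) * (aMat h c * X - X * aMat h c) * ((g⁻¹ : GLpq p q) : Mat p q) := by
            rw [mul_assoc _ _ (aMat h c), ← e2.eq, mul_sub, sub_mul]
            simp only [← mul_assoc]
            rw [e1.eq]
        _ = _ := by rw [e3]; simp
  | zero => simp
  | add X Y _ _ hX hY => rw [mul_add, add_mul]; exact add_mem hX hY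
  | smul c X _ hX =>
    rw [mul_smul_comm, smul_mul_assoc]; exact Submodule.smul_mem _ _ hX

theorem conj_mem_groupN (h : q ≤ p) {g n : GLpq p q} (hg : g ∈ aCentralizer h)
    (hn : n ∈ groupN h) : g * n * g⁻¹ ∈ groupN h := by
  induction hn using Subgroup.closure_induction with
  | mem n hn =>
    obtain ⟨X, hX, hn⟩ := hn
    refine Subgroup.subset_closure ⟨_, conj_mem_nSpace h hg hX, ?_⟩
    rw [Matrix.exp_units_conj, Units.val_mul, Units.val_mul, hn]
  | one => simp
  | mul a b _ _ ha hb =>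
    have : g * (a * b) * g⁻¹ = g * a * g⁻¹ * (g * b * g⁻¹) := by group
    rw [this]; exact mul_mem ha hb
  | inv a _ ha =>
    have : g * a⁻¹ * g⁻¹ = (g * a * g⁻¹)⁻¹ := by group
    rw [this]; exact inv_mem ha

theorem aCentralizer_le_normalizer_groupN (h : q ≤ p) :
    aCentralizer h ≤ Subgroup.normalizer (groupN h : Set (GLpq p q)) := by
  intro g hg
  rw [Subgroup.mem_normalizer_iff]
  refine fun n => ⟨conj_mem_groupN h hg, fun hn => ?_⟩
  have := conj_mem_groupN h (inv_mem hg) hn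
  rwa [show g⁻¹ * (g * n * g⁻¹) * g⁻¹⁻¹ = n by group] at this

theorem aCentralizer_le_normalizer_groupA (h : q ≤ p) :
    aCentralizer h ≤ Subgroup.normalizer (groupA h : Set (GLpq p q)) := by
  have key : ∀ g ∈ aCentralizer h, ∀ a ∈ groupA h, g * a * g⁻¹ ∈ groupA h := by
    intro g hg a ha
    rwa [(aCentralizer_commute_groupA h hg ha).eq, mul_inv_cancel_right]
  intro g hg
  rw [Subgroup.mem_normalizer_iff]
  refine fun a => ⟨key g hg a, fun ha => ?_⟩
  have := key _ (inv_mem hg) _ ha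
  rwa [show g⁻¹ * (g * a * g⁻¹) * g⁻¹⁻¹ = a by group] at this

/-- The products `k a n` form a group: `K'` centralizes `A`, and both normalize `N`. -/
theorem coe_KAN (h : q ≤ p) {K' : Subgroup (GLpq p q)} (hK' : K' ≤ K0 p q) :
    (KAN h K' : Set (GLpq p q)) =
      (K' : Set (GLpq p q)) * (groupA h : Set (GLpq p q)) * (groupN h : Set (GLpq p q)) := by
  have h1 : K' ≤ aCentralizer h := hK'.trans (K0_le_aCentralizer h)
  rw [KAN, Subgroup.coe_mul_of_left_le_normalizer_right (K' ⊔ groupA h) (groupN h)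
      ((sup_le h1 (groupA_le_aCentralizer h)).trans (aCentralizer_le_normalizer_groupN h)),
    Subgroup.coe_mul_of_left_le_normalizer_right K' (groupA h)
      (h1.trans (aCentralizer_le_normalizer_groupA h))]

theorem groupA_le_KAN (h : q ≤ p) (K' : Subgroup (GLpq p q)) : groupA h ≤ KAN h K' :=
  le_sup_right.trans le_sup_left

theorem groupN_le_KAN (h : q ≤ p) (K' : Subgroup (GLpq p q)) : groupN h ≤ KAN h K' :=
  le_sup_right

end GroupStructure

/-! ### Invariant oriented flags -/

section FlagPreserving

variable {p q : ℕ}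

/-- The set `hypInter h k` as a subspace: the common kernel of the null coordinates of (0-based)
index less than `k`. -/
def uFlag (h : q ≤ p) (k : ℕ) : Submodule ℝ (Vec p q) :=
  ⨅ (i : Fin q) (_ : (i : ℕ) < k), LinearMap.ker (uCoord h i)

theorem mem_uFlag {h : q ≤ p} {k : ℕ} {x : Vec p q} :
    x ∈ uFlag h k ↔ ∀ i : Fin q, (i : ℕ) < k → uCoord h i x = 0 := by
  simp [uFlag, Submodule.mem_iInf]

/-- Infinitesimal isometries which act on the flags `uFlag h k` and `∑_{i ≤ l} ℝ w_i`, with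
eigenvalues `c_k` and `-c_l` on the successive quotients. -/
structure IsInfTriangular (h : q ≤ p) (X : Mat p q) (c : Fin q → ℝ) : Prop where
  skew : ∀ x y, form (X *ᵥ x) y = -form x (X *ᵥ y)
  uCoord_eq : ∀ (k : Fin q) (x : Vec p q), x ∈ uFlag h k →
    uCoord h k (X *ᵥ x) = c k * uCoord h k x
  mem_span : ∀ (l : Fin q) (x : Vec p q), x ∈ Submodule.span ℝ (w h '' Set.Iic l) →
    X *ᵥ x ∈ Submodule.span ℝ (w h '' Set.Iic l)
  vCoord_eq : ∀ (l : Fin q) (x : Vec p q), x ∈ Submodule.span ℝ (w h '' Set.Iic l) →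
    vCoord h l (X *ᵥ x) = -c l * vCoord h l x

/-- Isometries which act on the flags `uFlag h k` and `∑_{i ≤ l} ℝ w_i`, with
positive eigenvalues on the one-dimensional successive quotients. -/
structure IsPosTriangular (h : q ≤ p) (B : Mat p q) : Prop where
  isometry : ∀ x y, form (B *ᵥ x) (B *ᵥ y) = form x y
  mem_uFlag : ∀ (k : ℕ) (x : Vec p q), x ∈ uFlag h k → B *ᵥ x ∈ uFlag h k
  uCoord_pos : ∀ (k : Fin q) (x : Vec p q), x ∈ uFlag h k → 0 < uCoord h k x →
    0 < uCoord h k (B *ᵥ x)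
  mem_span : ∀ (l : Fin q) (x : Vec p q), x ∈ Submodule.span ℝ (w h '' Set.Iic l) →
    B *ᵥ x ∈ Submodule.span ℝ (w h '' Set.Iic l)
  vCoord_pos : ∀ (l : Fin q) (x : Vec p q), x ∈ Submodule.span ℝ (w h '' Set.Iic l) →
    0 < vCoord h l x → 0 < vCoord h l (B *ᵥ x)

theorem IsInfTriangular.neg {h : q ≤ p} {X : Mat p q} {c : Fin q → ℝ}
    (hX : IsInfTriangular h X c) : IsInfTriangular h (-X) (-c) where
  skew x y := by
    rw [← form_comm, Matrix.neg_mulVec, Matrix.neg_mulVec, ← formLeft_apply, ← formLeft_apply,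
      map_neg, map_neg, formLeft_apply, formLeft_apply, form_comm, hX.skew]
  uCoord_eq k x hx := by simp [Matrix.neg_mulVec, hX.uCoord_eq k x hx]
  mem_span l x hx := by rw [Matrix.neg_mulVec]; exact neg_mem (hX.mem_span l x hx)
  vCoord_eq l x hx := by simp [Matrix.neg_mulVec, hX.vCoord_eq l x hx]

theorem IsInfTriangular.exp {h : q ≤ p} {X : Mat p q} {c : Fin q → ℝ}
    (hX : IsInfTriangular h X c) : IsPosTriangular h (NormedSpace.exp X) := by
  have hu : ∀ k : ℕ, ∀ x ∈ uFlag h k, X *ᵥ x ∈ uFlag h k := by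
    intro k x hx
    rw [mem_uFlag] at hx ⊢
    intro i hi
    rw [hX.uCoord_eq i x (mem_uFlag.2 fun j hj => hx j (hj.trans hi)), hx i hi, mul_zero]
  refine ⟨form_exp_mulVec hX.skew, fun k x hx => exp_mulVec_mem (hu k) hx, fun k x hx hpos => ?_,
    fun l x hx => exp_mulVec_mem (hX.mem_span l) hx, fun l x hx hpos => ?_⟩
  · rw [apply_exp_mulVec (hu k) _ (c k) (hX.uCoord_eq k) hx]
    positivity
  · rw [apply_exp_mulVec (hX.mem_span l) _ (-c l) (hX.vCoord_eq l) hx]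
    positivity

theorem isInfTriangular_aMat (h : q ≤ p) (c : Fin q → ℝ) : IsInfTriangular h (aMat h c) c where
  skew := form_aMat h c
  uCoord_eq k x _ := uCoord_aMat h c x k
  mem_span l x hx := by
    rw [mem_span_w_iff] at hx ⊢
    exact ⟨fun i => by simp [hx.1], by simp, fun i hi => by simp [hx.2.2 i hi]⟩
  vCoord_eq l x _ := vCoord_aMat h c x l

theorem isInfTriangular_k0 (h : q ≤ p) {Y : Mat p q} (hY : Y ∈ k0Set p q) :
    IsInfTriangular h Y 0 where
  skew := mem_so'_iff.1 hY.1
  uCoord_eq k x _ := by simp [uCoord_k0 h hY]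
  mem_span l x hx := by
    rw [k0_mulVec_eq_zero hY ((mem_span_w_iff h _ _).1 hx).2.1]
    exact zero_mem _
  vCoord_eq l x _ := by simp [vCoord_k0 h hY]

theorem nSpace_skew (h : q ≤ p) {X : Mat p q} (hX : X ∈ nSpace h) (x y : Vec p q) :
    form (X *ᵥ x) y = -form x (X *ᵥ y) := by
  induction hX using Submodule.span_induction with
  | mem X hX =>
    simp only [Set.mem_iUnion] at hX
    obtain ⟨φ, hφ, hX⟩ := hX
    exact mem_so'_iff.1 hX.1 x y
  | zero => simp [form]
  | add X Y _ _ hX hY =>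
    rw [Matrix.add_mulVec, Matrix.add_mulVec, form_add_left, form_add_right, hX, hY]; ring
  | smul c X _ hX =>
    rw [Matrix.smul_mulVec, Matrix.smul_mulVec, form_smul_left, form_smul_right, hX]; ring

theorem isInfTriangular_nSpace (h : q ≤ p) {X : Mat p q} (hX : X ∈ nSpace h) :
    IsInfTriangular h X 0 where
  skew := nSpace_skew h hX
  uCoord_eq k x hx := by
    rw [uCoord_nSpace h hX fun i hi => mem_uFlag.1 hx i hi]; simp
  mem_span l x hx :=
    Submodule.span_mono (Set.image_mono Set.Iio_subset_Iic_self) (nSpace_mulVec_mem_span_w h hX hx)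
  vCoord_eq l x hx := by
    rw [((mem_span_w_iff h _ _).1 (nSpace_mulVec_mem_span_w h hX hx)).2.2 l (by simp)]; simp

theorem IsPosTriangular.mul {h : q ≤ p} {B C : Mat p q} (hB : IsPosTriangular h B)
    (hC : IsPosTriangular h C) : IsPosTriangular h (B * C) := by
  constructor <;> intro k x <;> rw [← Matrix.mulVec_mulVec]
  · rw [← Matrix.mulVec_mulVec, hB.isometry, hC.isometry]
  · exact fun hx => hB.mem_uFlag _ _ (hC.mem_uFlag _ _ hx)
  · exact fun hx hp => hB.uCoord_pos _ _ (hC.mem_uFlag _ _ hx) (hC.uCoord_pos _ _ hx hp)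
  · exact fun hx => hB.mem_span _ _ (hC.mem_span _ _ hx)
  · exact fun hx hp => hB.vCoord_pos _ _ (hC.mem_span _ _ hx) (hC.vCoord_pos _ _ hx hp)

theorem isPosTriangular_one (h : q ≤ p) : IsPosTriangular h (1 : Mat p q) := by
  constructor <;> simp

/-- The group of isometries which preserve the two flags and the orientations of their
one-dimensional successive quotients. -/
def posTriangularGroup (h : q ≤ p) : Subgroup (GLpq p q) where
  carrier := {g | IsPosTriangular h (g : Mat p q) ∧
    IsPosTriangular h ((g⁻¹ : GLpq p q) : Mat p q)}
  mul_mem' := by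
    rintro a b ⟨ha, ha'⟩ ⟨hb, hb'⟩
    refine ⟨by rw [Units.val_mul]; exact ha.mul hb, ?_⟩
    rw [mul_inv_rev, Units.val_mul]
    exact hb'.mul ha'
  one_mem' := by
    refine ⟨isPosTriangular_one h, ?_⟩
    rw [inv_one]
    exact isPosTriangular_one h
  inv_mem' := fun {a} ha => ⟨ha.2, by rw [inv_inv]; exact ha.1⟩

theorem expGroup_le_posTriangularGroup (h : q ≤ p) {s : Set (Mat p q)}
    (hs : ∀ X ∈ s, ∃ c, IsInfTriangular h X c) : expGroup s ≤ posTriangularGroup h := by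
  refine (Subgroup.closure_le _).2 ?_
  rintro g ⟨X, hX, hg⟩
  obtain ⟨c, hc⟩ := hs X hX
  exact ⟨by rw [hg]; exact hc.exp, by rw [coe_inv_eq_exp_neg hg]; exact hc.neg.exp⟩

theorem KAN_le_posTriangularGroup (h : q ≤ p) {K' : Subgroup (GLpq p q)} (hK' : K' ≤ K0 p q) :
    KAN h K' ≤ posTriangularGroup h := by
  refine sup_le (sup_le (hK'.trans ?_) ?_) ?_
  · exact expGroup_le_posTriangularGroup h fun Y hY => ⟨0, isInfTriangular_k0 h hY⟩
  · refine expGroup_le_posTriangularGroup h ?_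
    rintro _ ⟨c, rfl⟩
    exact ⟨c, isInfTriangular_aMat h c⟩
  · exact expGroup_le_posTriangularGroup h fun X hX => ⟨0, isInfTriangular_nSpace h hX⟩

theorem isPosTriangular_of_mem_KAN (h : q ≤ p) {K' : Subgroup (GLpq p q)} (hK' : K' ≤ K0 p q)
    {g : GLpq p q} (hg : g ∈ KAN h K') : IsPosTriangular h (g : Mat p q) :=
  (KAN_le_posTriangularGroup h hK' hg).1

end FlagPreserving

/-! ### Tangent spaces of orbits -/

section TangentSpace

variable {p q : ℕ}

theorem lieAlg_apply_eq_zero {G : Subgroup (GLpq p q)} {X : Mat p q} (hX : X ∈ lieAlg G)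
    (f : Vec p q →ₗ[ℝ] ℝ) {x : Vec p q} (hf : ∀ g ∈ G, f ((g : Mat p q) *ᵥ x) = 0) :
    f (X *ᵥ x) = 0 := by
  have h1 := (LinearMap.toContinuousLinearMap f).hasFDerivAt.comp_hasDerivAt (0 : ℝ)
    (hasDerivAt_exp_mulVec X x)
  have h2 : ∀ t : ℝ, f (NormedSpace.exp (t • X) *ᵥ x) = 0 := by
    intro t
    obtain ⟨g, hg, e⟩ := hX t
    rw [← e, hf g hg]
  have h3 : (LinearMap.toContinuousLinearMap f ∘ fun t : ℝ => NormedSpace.exp (t • X) *ᵥ x) =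
      fun _ => 0 := funext h2
  rw [h3] at h1
  exact (h1.unique (hasDerivAt_const _ _))

/-- The Lie algebra of a group of isometries is skew on the diagonal: `⟨x, exp(tX) x⟩` is an even
function of `t`. -/
theorem form_lieAlg_self {G : Subgroup (GLpq p q)} {X : Mat p q} (hX : X ∈ lieAlg G)
    (hG : ∀ g ∈ G, ∀ x y, form ((g : Mat p q) *ᵥ x) ((g : Mat p q) *ᵥ y) = form x y)
    (x : Vec p q) : form x (X *ᵥ x) = 0 := by
  have h1 := (LinearMap.toContinuousLinearMap (formLeft x)).hasFDerivAt.comp_hasDerivAt (0 : ℝ)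
    (hasDerivAt_exp_mulVec X x)
  have h2 := (LinearMap.toContinuousLinearMap (formLeft x)).hasFDerivAt.comp_hasDerivAt (0 : ℝ)
    (hasDerivAt_exp_mulVec (-X) x)
  have h3 : (LinearMap.toContinuousLinearMap (formLeft x) ∘
        fun t : ℝ => NormedSpace.exp (t • X) *ᵥ x) =
      (LinearMap.toContinuousLinearMap (formLeft x) ∘
        fun t : ℝ => NormedSpace.exp (t • -X) *ᵥ x) := by
    ext t
    obtain ⟨g, hg, e⟩ := hX t
    change form x (NormedSpace.exp (t • X) *ᵥ x) = form x (NormedSpace.exp (t • -X) *ᵥ x)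
    rw [smul_neg, ← coe_inv_eq_exp_neg e, ← e]
    conv_rhs => rw [← hG g hg, mulVec_inv_mulVec, form_comm]
  rw [h3] at h1
  have h4 : form x (X *ᵥ x) = form x (-X *ᵥ x) := h1.unique h2
  rw [Matrix.neg_mulVec] at h4
  have h5 : form x (-(X *ᵥ x)) = -form x (X *ᵥ x) := (formLeft x).map_neg _
  linarith

theorem smul_aMat (h : q ≤ p) (t : ℝ) (c : Fin q → ℝ) : t • aMat h c = aMat h (t • c) := by
  ext (i | i) (j | j) <;> simp [aMat]

theorem aMat_mem_lieAlg (h : q ≤ p) (K' : Subgroup (GLpq p q)) (c : Fin q → ℝ) :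
    aMat h c ∈ lieAlg (KAN h K') := by
  intro t
  obtain ⟨g, hg, e⟩ := exists_mem_expGroup (s := aSet h) ⟨t • c, rfl⟩
  exact ⟨g, groupA_le_KAN h K' hg, by rw [e, smul_aMat]⟩

theorem mem_lieAlg_of_mem_nSpace (h : q ≤ p) (K' : Subgroup (GLpq p q)) {X : Mat p q}
    (hX : X ∈ nSpace h) : X ∈ lieAlg (KAN h K') := by
  intro t
  obtain ⟨g, hg, e⟩ := exists_mem_expGroup (s := (nSpace h : Set (Mat p q)))
    (Submodule.smul_mem _ t hX)
  exact ⟨g, groupN_le_KAN h K' hg, e⟩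

/-- The tangent space at `x` of the orbit of `x`. -/
def orbitTangent (G : Subgroup (GLpq p q)) (x : Vec p q) : Submodule ℝ (Vec p q) :=
  Submodule.span ℝ ((fun X : Mat p q => X *ᵥ x) '' lieAlg G)

theorem mulVec_mem_orbitTangent {G : Subgroup (GLpq p q)} {X : Mat p q} (hX : X ∈ lieAlg G)
    (x : Vec p q) : X *ᵥ x ∈ orbitTangent G x := Submodule.subset_span ⟨X, hX, rfl⟩

theorem orbitTangent_le_flagTangent (h : q ≤ p) {K' : Subgroup (GLpq p q)} (hK' : K' ≤ K0 p q)
    {k : ℕ} {x : Vec p q} (hx : x ∈ uFlag h k) :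
    orbitTangent (KAN h K') x ≤ flagTangent h k x := by
  refine Submodule.span_le.2 ?_
  rintro _ ⟨X, hX, rfl⟩
  refine ⟨fun i hi => lieAlg_apply_eq_zero hX _ fun g hg => ?_, form_lieAlg_self hX
    (fun g hg => (isPosTriangular_of_mem_KAN h hK' hg).isometry) x⟩
  exact mem_uFlag.1 ((isPosTriangular_of_mem_KAN h hK' hg).mem_uFlag k x hx) i hi

theorem orbitTangent_le_span_w (h : q ≤ p) {K' : Subgroup (GLpq p q)} (hK' : K' ≤ K0 p q)
    {l : Fin q} {x : Vec p q} (hx : x ∈ Submodule.span ℝ (w h '' Set.Iic l)) :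
    orbitTangent (KAN h K') x ≤ Submodule.span ℝ (w h '' Set.Iic l) := by
  refine Submodule.span_le.2 ?_
  rintro _ ⟨X, hX, rfl⟩
  have key : ∀ g ∈ KAN h K', _ := fun g hg =>
    (mem_span_w_iff h _ _).1 ((isPosTriangular_of_mem_KAN h hK' hg).mem_span l x hx)
  refine (mem_span_w_iff h _ _).2 ⟨fun i => ?_, ?_, fun i hi => ?_⟩
  · exact lieAlg_apply_eq_zero hX _ fun g hg => (key g hg).1 i
  · ext a
    exact lieAlg_apply_eq_zero hX
      (LinearMap.proj (R := ℝ) (φ := fun _ => ℝ) a ∘ₗ corePart p q)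
      fun g hg => congrFun (key g hg).2.1 a
  · exact lieAlg_apply_eq_zero hX _ fun g hg => (key g hg).2.2 i hi

/-- At a point off the degenerate subspace the orbit is as large as the invariant flag allows. -/
theorem orbitTangent_eq_flagTangent (h : q ≤ p) {K' : Subgroup (GLpq p q)} (hK' : K' ≤ K0 p q)
    {k : Fin q} {x : Vec p q} (hx : x ∈ uFlag h k) (hk : uCoord h k x ≠ 0) :
    orbitTangent (KAN h K') x = flagTangent h k x := by
  refine le_antisymm (orbitTangent_le_flagTangent h hK' hx) ?_
  rintro y ⟨hy, hy'⟩
  let H := aMat h (Pi.single k 1)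
  -- `H x` accounts for the component of `y` along the null coordinate `k`; the rest is `b ∧ w_k`
  -- applied to `x`, up to a factor, because it is orthogonal to `x`.
  let b := y - (uCoord h k y / uCoord h k x) • H *ᵥ x
  have hb : ∀ i ≤ k, uCoord h i b = 0 := by
    intro i hi
    rcases hi.lt_or_eq with hi | rfl
    · simp [b, H, hy i hi, mem_uFlag.1 hx i hi]
    · simp [b, H, hk]
  have hbx : form b x = 0 := by
    have e : form x (H *ᵥ x) = 0 := by
      have := form_aMat h (Pi.single k 1) x x
      rw [form_comm] at this
      linarith
    rw [form_comm]
    simp only [b, form_sub_right, form_smul_right, e, hy', mul_zero, sub_zero]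
  have e : y = (uCoord h k y / uCoord h k x) • H *ᵥ x +
      (uCoord h k x)⁻¹ • (wedge b (w h k) *ᵥ x) := by
    rw [wedge_mulVec, hbx, form_w_left, zero_smul, sub_zero, inv_smul_smul₀ hk]
    simp [b]
  rw [e]
  exact add_mem
    (Submodule.smul_mem _ _ (mulVec_mem_orbitTangent (aMat_mem_lieAlg h K' _) x))
    (Submodule.smul_mem _ _ (mulVec_mem_orbitTangent
      (mem_lieAlg_of_mem_nSpace h K' (wedge_w_mem_nSpace h k hb)) x))

theorem orbitDim_of_uCoord_ne_zero (h : q ≤ p) {K' : Subgroup (GLpq p q)} (hK' : K' ≤ K0 p q)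
    {k : Fin q} {x : Vec p q} (hx : x ∈ uFlag h k) (hk : uCoord h k x ≠ 0) :
    orbitDim (KAN h K') x = p + q - (k + 1) := by
  have e : orbitDim (KAN h K') x = Module.finrank ℝ (flagTangent h k x) := by
    rw [← orbitTangent_eq_flagTangent h hK' hx hk]; rfl
  have := finrank_flagTangent h k k.2.le x (w h k) (fun i _ => uCoord_w h i k)
    (by rwa [form_comm, form_w_left])
  omega

/-- At a point of the degenerate subspace with nonzero definite part, the orbit tangent space contains
the span of the `w_i`, and it is contained in the tangent space of a cylinder of dimension
`p - 1`. -/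
theorem orbitDim_of_corePart_ne_zero (h : q ≤ p) {K' : Subgroup (GLpq p q)} (hK' : K' ≤ K0 p q)
    {x : Vec p q} (hx : ∀ i, uCoord h i x = 0) (hc : corePart p q x ≠ 0) :
    orbitDim (KAN h K') x ∈ Set.Ico q p := by
  have hpos := form_corePart_self_pos hc
  have e : form (corePart p q x) x = form (corePart p q x) (corePart p q x) := by
    rw [form_comm, form_corePart]
  constructor
  · refine (finrank_wSpan h).symm.le.trans
      (Submodule.finrank_mono (t := orbitTangent (KAN h K') x) (Submodule.span_le.2 ?_))
    rintro _ ⟨k, rfl⟩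
    have : w h k = (-(form (corePart p q x) (corePart p q x))⁻¹) •
        (wedge (corePart p q x) (w h k) *ᵥ x) := by
      rw [wedge_mulVec, form_w_left, hx, zero_smul, zero_sub, neg_smul_neg, e,
        inv_smul_smul₀ hpos.ne']
    rw [SetLike.mem_coe, this]
    exact Submodule.smul_mem _ _ (mulVec_mem_orbitTangent
      (mem_lieAlg_of_mem_nSpace h K' (wedge_w_mem_nSpace h k fun i _ => by simp)) x)
  · have h1 : orbitDim (KAN h K') x ≤ Module.finrank ℝ (flagTangent h q x) :=
      Submodule.finrank_mono (orbitTangent_le_flagTangent h hK' (mem_uFlag.2 fun i _ => hx i))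
    have h2 := finrank_flagTangent h q le_rfl x (corePart p q x) (fun i _ => by simp)
      (by rw [form_comm, e]; exact hpos.ne')
    omega

/-- The elements `b ∧ z_l` with `b ∈ ∑_{i < l} ℝ w_i` lie in `𝔫`. -/
theorem wedge_zVec_mem_nSpace (h : q ≤ p) (l : Fin q) {b : Vec p q}
    (hb : b ∈ Submodule.span ℝ (w h '' Set.Iio l)) : wedge b (zVec h l) ∈ nSpace h := by
  have : Submodule.span ℝ (w h '' Set.Iio l) ≤ (nSpace h).comap (wedgeWith (zVec h l)) := by
    refine Submodule.span_le.2 ?_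
    rintro _ ⟨i, hi, rfl⟩
    exact wedge_mem_nSpace h (fun c => aMat_mulVec_w h c i) (fun c => aMat_mulVec_zVec h c l)
      (Or.inl ⟨i, l, hi, Or.inr (sub_eq_add_neg _ _).symm⟩)
  exact this hb

/-- At a combination of the `w_i` with last nonzero coefficient at `w_l`, the elements `w_i ∧ z_l` give
the directions `w_i` with `i < l`, and `𝔞` gives `w_l`. -/
theorem orbitTangent_eq_span_w (h : q ≤ p) {K' : Subgroup (GLpq p q)} (hK' : K' ≤ K0 p q)
    {l : Fin q} {x : Vec p q} (hx : x ∈ Submodule.span ℝ (w h '' Set.Iic l))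
    (hl : vCoord h l x ≠ 0) :
    orbitTangent (KAN h K') x = Submodule.span ℝ (w h '' Set.Iic l) := by
  refine le_antisymm (orbitTangent_le_span_w h hK' hx) (Submodule.span_le.2 ?_)
  obtain ⟨hu, hc, hv⟩ := (mem_span_w_iff h _ _).1 hx
  rintro _ ⟨i, hi, rfl⟩
  rcases (Set.mem_Iic.1 hi).lt_or_eq with hi | rfl
  · have : w h i = (vCoord h l x)⁻¹ • (wedge (w h i) (zVec h l) *ᵥ x) := by
      rw [wedge_mulVec, form_w_left, hu, zero_smul, sub_zero, form_zVec_left, inv_smul_smul₀ hl]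
    rw [SetLike.mem_coe, this]
    exact Submodule.smul_mem _ _ (mulVec_mem_orbitTangent (mem_lieAlg_of_mem_nSpace h K'
      (wedge_zVec_mem_nSpace h l (Submodule.subset_span ⟨i, hi, rfl⟩))) x)
  · have : w h i = (-2 * (vCoord h i x)⁻¹) • (aMat h (Pi.single i 1) *ᵥ x) := by
      apply ext_coord h
      · simp [hu]
      · intro j
        by_cases hj : j = i
        · subst hj; simp [hl]
        · simp [hj]
      · simp
    rw [SetLike.mem_coe, this]
    exact Submodule.smul_mem _ _ (mulVec_mem_orbitTangent (aMat_mem_lieAlg h K' _) x)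

theorem orbitDim_of_mem_span_w (h : q ≤ p) {K' : Subgroup (GLpq p q)} (hK' : K' ≤ K0 p q)
    {l : Fin q} {x : Vec p q} (hx : x ∈ Submodule.span ℝ (w h '' Set.Iic l))
    (hl : vCoord h l x ≠ 0) : orbitDim (KAN h K') x = l + 1 := by
  rw [← finrank_span_w_Iic h l, ← orbitTangent_eq_span_w h hK' hx hl]; rfl

end TangentSpace

/-! ### Determination of the orbits -/

section Orbits

variable {p q : ℕ}

/-- The piece of the level set `⟨x, x⟩ = ρ` on which the null coordinates of index less than `k`
vanish and the one of index `k` has the sign of `ε`. Only the sign of `ε` matters. -/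
def levelPiece (h : q ≤ p) (k : Fin q) (ε ρ : ℝ) : Set (Vec p q) :=
  {x | x ∈ uFlag h k ∧ 0 < ε * uCoord h k x ∧ form x x = ρ}

/-- The half-space of those vectors of `∑_{i ≤ l} ℝ w_i` whose coefficient at `w_l` has the sign
of `ε`. Only the sign of `ε` matters. -/
def wPiece (h : q ≤ p) (l : Fin q) (ε : ℝ) : Set (Vec p q) :=
  {x | x ∈ Submodule.span ℝ (w h '' Set.Iic l) ∧ 0 < ε * vCoord h l x}

theorem exists_groupA_scaling (h : q ≤ p) (c : Fin q → ℝ) :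
    ∃ a ∈ groupA h, ∀ (x : Vec p q) (i : Fin q),
      uCoord h i ((a : Mat p q) *ᵥ x) = Real.exp (c i) * uCoord h i x ∧
      vCoord h i ((a : Mat p q) *ᵥ x) = Real.exp (-c i) * vCoord h i x := by
  obtain ⟨a, ha, e⟩ := exists_mem_expGroup (s := aSet h) ⟨c, rfl⟩
  refine ⟨a, ha, fun x i => ⟨?_, ?_⟩⟩ <;> rw [e]
  · exact apply_exp_mulVec (S := ⊤) (fun _ _ => trivial) _ _ (fun y _ => uCoord_aMat h c y i) trivial
  · exact apply_exp_mulVec (S := ⊤) (fun _ _ => trivial) _ _ (fun y _ => vCoord_aMat h c y i) trivial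

theorem IsPosTriangular.mul_uCoord_pos {h : q ≤ p} {B : Mat p q} (hB : IsPosTriangular h B)
    {k : Fin q} {x : Vec p q} (hx : x ∈ uFlag h k) {ε : ℝ} (hε : 0 < ε * uCoord h k x) :
    0 < ε * uCoord h k (B *ᵥ x) := by
  have := hB.uCoord_pos k (ε • x) (Submodule.smul_mem _ _ hx) (by simpa using hε)
  simpa [Matrix.mulVec_smul] using this

theorem IsPosTriangular.mul_vCoord_pos {h : q ≤ p} {B : Mat p q} (hB : IsPosTriangular h B)
    {l : Fin q} {x : Vec p q} (hx : x ∈ Submodule.span ℝ (w h '' Set.Iic l)) {ε : ℝ}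
    (hε : 0 < ε * vCoord h l x) : 0 < ε * vCoord h l (B *ᵥ x) := by
  have := hB.vCoord_pos l (ε • x) (Submodule.smul_mem _ _ hx) (by simpa using hε)
  simpa [Matrix.mulVec_smul] using this

theorem form_add_smul_w (h : q ≤ p) (k : Fin q) (x : Vec p q) (s : ℝ) :
    form (x + s • w h k) (x + s • w h k) = form x x + 2 * s * uCoord h k x := by
  simp only [form_add_left, form_add_right, form_smul_left, form_smul_right, form_w_left,
    form_comm x (w h k), uCoord_w]
  ring

/-- A Siegel transformation in `N` carries `x` to any point of the same level set with the same
first nonvanishing null coordinate. -/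
theorem exists_groupN_mulVec_eq (h : q ≤ p) {k : Fin q} {x y : Vec p q} (hx : x ∈ uFlag h k)
    (hy : y ∈ uFlag h k) (hxy : uCoord h k x = uCoord h k y) (hk : uCoord h k x ≠ 0)
    (hform : form x x = form y y) : ∃ n ∈ groupN h, (n : Mat p q) *ᵥ x = y := by
  let b := (uCoord h k x)⁻¹ • (y - x)
  have hb : ∀ i ≤ k, uCoord h i b = 0 := by
    intro i hi
    rcases hi.lt_or_eq with hi | rfl
    · simp [b, mem_uFlag.1 hx i hi, mem_uFlag.1 hy i hi]
    · simp [b, hxy]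
  let X := wedge b (w h k)
  have hX : X ∈ nSpace h := wedge_w_mem_nSpace h k hb
  obtain ⟨n, hn, e⟩ := exists_mem_expGroup (s := (nSpace h : Set (Mat p q))) hX
  refine ⟨n, hn, ?_⟩
  have hXx : X *ᵥ x = (y - x) - form b x • w h k := by
    simp only [X, wedge_mulVec, form_w_left, b, smul_inv_smul₀ hk]
  let S : Submodule ℝ (Vec p q) := Submodule.span ℝ {w h k}
  have hS : ∀ z ∈ S, X *ᵥ z ∈ S := by
    intro z hz
    obtain ⟨s, rfl⟩ := Submodule.mem_span_singleton.1 hz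
    simp only [X, Matrix.mulVec_smul, wedge_mulVec, form_w_left, uCoord_w, zero_smul, zero_sub]
    exact S.smul_mem _ (S.neg_mem (S.smul_mem _ (Submodule.mem_span_singleton_self _)))
  have hXX : X *ᵥ X *ᵥ x ∈ S := by
    have : form (w h k) (X *ᵥ x) = 0 := by
      rw [hXx, form_w_left]; simp [hxy]
    rw [show X *ᵥ X *ᵥ x = wedge b (w h k) *ᵥ (X *ᵥ x) from rfl, wedge_mulVec, this, zero_smul,
      zero_sub]
    exact S.neg_mem (S.smul_mem _ (Submodule.mem_span_singleton_self _))
  -- Up to a multiple of `w_k` the exponential is `x + X x`, hence `y`; the form fixes the multiple.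
  have h1 := exp_mulVec_sub_mem hS hXX
  rw [hXx] at h1
  obtain ⟨s, hs⟩ := Submodule.mem_span_singleton.1 h1
  have h2 : NormedSpace.exp X *ᵥ x = y + (s - form b x) • w h k := by
    rw [sub_smul, hs]; abel
  have h3 := form_exp_mulVec (nSpace_skew h hX) x x
  rw [h2, form_add_smul_w, hform, ← hxy] at h3
  have h4 : s - form b x = 0 := by
    have : (s - form b x) * uCoord h k x = 0 := by linarith
    exact (mul_eq_zero.1 this).resolve_right hk
  rw [e, h2, h4, zero_smul, add_zero]

/-- `A` adjusts the first nonzero null coordinate up to a positive factor, and a Siegel transformation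
in `N` then adjusts all the others. -/
theorem orbit_eq_levelPiece (h : q ≤ p) {K' : Subgroup (GLpq p q)} (hK' : K' ≤ K0 p q)
    {k : Fin q} {x : Vec p q} (hx : x ∈ uFlag h k) (hk : uCoord h k x ≠ 0) :
    orbit (KAN h K') x = levelPiece h k (uCoord h k x) (form x x) := by
  ext y
  constructor
  · rintro ⟨g, hg, rfl⟩
    have := isPosTriangular_of_mem_KAN h hK' hg
    exact ⟨this.mem_uFlag _ _ hx, this.mul_uCoord_pos hx (mul_self_pos.2 hk), this.isometry _ _⟩
  · rintro ⟨hy, hpos, hform⟩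
    have hq : 0 < uCoord h k y / uCoord h k x := by
      rwa [div_pos_iff, ← mul_pos_iff, mul_comm]
    obtain ⟨a, ha, ha'⟩ := exists_groupA_scaling h
      (Pi.single k (Real.log (uCoord h k y / uCoord h k x)))
    have hP := isPosTriangular_of_mem_KAN h hK' (groupA_le_KAN h K' ha)
    have e : uCoord h k ((a : Mat p q) *ᵥ x) = uCoord h k y := by
      rw [(ha' x k).1, Pi.single_eq_same, Real.exp_log hq, div_mul_cancel₀ _ hk]
    obtain ⟨n, hn, hn'⟩ := exists_groupN_mulVec_eq h (hP.mem_uFlag _ _ hx) hy e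
      (by rw [e]; exact right_ne_zero_of_mul hpos.ne') (by rw [hP.isometry, hform])
    refine ⟨n * a, mul_mem (groupN_le_KAN h K' hn) (groupA_le_KAN h K' ha), ?_⟩
    rw [Units.val_mul, ← Matrix.mulVec_mulVec, hn']

/-- On the span of the `w_i`, `A` adjusts the last nonzero coefficient up to a positive factor, and an
element `b ∧ z_l` of `𝔫` then adjusts all the earlier ones. -/
theorem orbit_eq_wPiece (h : q ≤ p) {K' : Subgroup (GLpq p q)} (hK' : K' ≤ K0 p q)
    {l : Fin q} {x : Vec p q} (hx : x ∈ Submodule.span ℝ (w h '' Set.Iic l))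
    (hl : vCoord h l x ≠ 0) : orbit (KAN h K') x = wPiece h l (vCoord h l x) := by
  ext y
  constructor
  · rintro ⟨g, hg, rfl⟩
    have := isPosTriangular_of_mem_KAN h hK' hg
    exact ⟨this.mem_span _ _ hx, this.mul_vCoord_pos hx (mul_self_pos.2 hl)⟩
  · rintro ⟨hy, hpos⟩
    have hq : 0 < vCoord h l y / vCoord h l x := by
      rwa [div_pos_iff, ← mul_pos_iff, mul_comm]
    obtain ⟨a, ha, ha'⟩ := exists_groupA_scaling h
      (Pi.single l (-Real.log (vCoord h l y / vCoord h l x)))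
    have hP := isPosTriangular_of_mem_KAN h hK' (groupA_le_KAN h K' ha)
    set x' := (a : Mat p q) *ᵥ x with hx'_def
    have e : vCoord h l x' = vCoord h l y := by
      rw [(ha' x l).2, Pi.single_eq_same, neg_neg, Real.exp_log hq, div_mul_cancel₀ _ hl]
    have hl' : vCoord h l x' ≠ 0 := by rw [e]; exact right_ne_zero_of_mul hpos.ne'
    have hx' := (mem_span_w_iff h _ _).1 (hP.mem_span l x hx)
    have hy' := (mem_span_w_iff h _ _).1 hy
    let b := (vCoord h l x')⁻¹ • (y - x')
    have hb : b ∈ Submodule.span ℝ (w h '' Set.Iio l) := by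
      refine Submodule.smul_mem _ _ ((mem_span_w_iff h _ _).2 ⟨fun i => ?_, ?_, fun i hi => ?_⟩)
      · rw [map_sub, hy'.1, hx'.1, sub_zero]
      · rw [map_sub, hy'.2.1, hx'.2.1, sub_zero]
      · rcases (not_lt.1 (mt Set.mem_Iio.2 hi)).lt_or_eq with hi | rfl
        · rw [map_sub, hy'.2.2 i (mt Set.mem_Iic.1 (not_le.2 hi)),
            hx'.2.2 i (mt Set.mem_Iic.1 (not_le.2 hi)), sub_zero]
        · rw [map_sub, e, sub_self]
    have hbu := ((mem_span_w_iff h _ _).1 hb)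
    have hform : ∀ z : Vec p q, (∀ i, uCoord h i z = 0) → form b z = 0 := by
      intro z hz
      rw [form_eq_sum h, hbu.2.1]
      simp [hbu.1, hz, form]
    have hXx : wedge b (zVec h l) *ᵥ x' = y - x' := by
      rw [wedge_mulVec, form_zVec_left, hform x' hx'.1, zero_smul, sub_zero, smul_inv_smul₀ hl']
    have hXX : wedge b (zVec h l) *ᵥ wedge b (zVec h l) *ᵥ x' = 0 := by
      rw [hXx, wedge_mulVec, form_zVec_left, map_sub, e, sub_self, zero_smul,
        hform _ (fun i => by rw [map_sub, hy'.1, hx'.1, sub_zero]), zero_smul, sub_zero]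
    obtain ⟨n, hn, hn'⟩ := exists_mem_expGroup (s := (nSpace h : Set (Mat p q)))
      (wedge_zVec_mem_nSpace h l hb)
    refine ⟨n * a, mul_mem (groupN_le_KAN h K' hn) (groupA_le_KAN h K' ha), ?_⟩
    rw [Units.val_mul, ← Matrix.mulVec_mulVec, hn', exp_mulVec_of_sq_eq_zero hXX, hXx,
      add_sub_cancel]

/-- At a point of the degenerate subspace with nonzero definite part, `N` acts transitively on the
translates by the span of the `w_i`. -/
theorem exists_groupN_translation (h : q ≤ p) {x : Vec p q} (hx : ∀ i, uCoord h i x = 0)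
    (hc : corePart p q x ≠ 0) {b : Vec p q} (hb : b ∈ wSpan h) :
    ∃ n ∈ groupN h, (n : Mat p q) *ᵥ x = x + b := by
  have hpos := form_corePart_self_pos hc
  let c := corePart p q x
  let X := wedge ((form c c)⁻¹ • b) c
  have hX : X ∈ nSpace h := by
    have : wSpan h ≤ (nSpace h).comap (wedgeWith c) := by
      refine Submodule.span_le.2 ?_
      rintro _ ⟨j, rfl⟩
      refine wedge_mem_nSpace h (β := 0) (fun d => aMat_mulVec_w h d j) (fun d => ?_)
        (Or.inr ⟨j, add_zero _⟩)
      rw [aMat_mulVec_corePart]; simp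
    exact this (Submodule.smul_mem _ _ hb)
  obtain ⟨hbu, hbc⟩ := (mem_wSpan_iff h _).1 hb
  have hform : ∀ z : Vec p q, (∀ i, uCoord h i z = 0) → form b z = 0 := by
    intro z hz
    rw [form_eq_sum h, hbc]
    simp [hbu, hz, form]
  have hcx : form c x = form c c := by rw [form_comm, form_corePart]
  have hXx : X *ᵥ x = b := by
    rw [wedge_mulVec, hcx, form_smul_left, hform x hx, mul_zero, zero_smul, sub_zero,
      smul_inv_smul₀ hpos.ne']
  have hXX : X *ᵥ X *ᵥ x = 0 := by
    rw [hXx, wedge_mulVec, form_comm c, hform c (fun i => uCoord_corePart h i x), form_smul_left,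
      hform b hbu]
    simp
  obtain ⟨n, hn, hn'⟩ := exists_mem_expGroup (s := (nSpace h : Set (Mat p q))) hX
  exact ⟨n, hn, by rw [hn', exp_mulVec_of_sq_eq_zero hXX, hXx]⟩

/-- If the generators map the degenerate subspace into the span of the `w_i`, the group acts
trivially on the quotient, which is the definite part. -/
theorem corePart_expGroup (h : q ≤ p) {s : Set (Mat p q)}
    (hs : ∀ X ∈ s, ∃ c, IsInfTriangular h X c)
    (hc : ∀ X ∈ s, ∀ x, (∀ i, uCoord h i x = 0) → corePart p q (X *ᵥ x) = 0)
    {g : GLpq p q} (hg : g ∈ expGroup s) :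
    ∀ x ∈ uFlag h q, corePart p q ((g : Mat p q) *ᵥ x) = corePart p q x := by
  have hP : ∀ g ∈ expGroup s, ∀ x ∈ uFlag h q, (g : Mat p q) *ᵥ x ∈ uFlag h q :=
    fun g hg => (expGroup_le_posTriangularGroup h hs hg).1.mem_uFlag q
  induction hg using Subgroup.closure_induction with
  | mem g hg =>
    obtain ⟨X, hX, e⟩ := hg
    obtain ⟨c, hcX⟩ := hs X hX
    intro x hx
    ext a
    have := apply_exp_mulVec (X := X) (S := uFlag h q) (x := x) (fun y hy => ?_)
      (LinearMap.proj (R := ℝ) (φ := fun _ => ℝ) a ∘ₗ corePart p q) 0 (fun y hy => ?_) hx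
    · simpa [e] using this
    · exact mem_uFlag.2 fun i hi => by
        rw [hcX.uCoord_eq i y (mem_uFlag.2 fun j _ => mem_uFlag.1 hy j j.2),
          mem_uFlag.1 hy i hi, mul_zero]
    · simp [hc X hX y fun i => mem_uFlag.1 hy i i.2]
  | one => simp
  | mul a b ha hb iha ihb =>
    intro x hx
    rw [Units.val_mul, ← Matrix.mulVec_mulVec, iha _ (hP b hb x hx), ihb x hx]
  | inv a ha iha =>
    intro x hx
    rw [← iha _ (hP _ (inv_mem ha) x hx), mulVec_inv_mulVec]

theorem corePart_groupA (h : q ≤ p) {g : GLpq p q} (hg : g ∈ groupA h) {x : Vec p q}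
    (hx : x ∈ uFlag h q) : corePart p q ((g : Mat p q) *ᵥ x) = corePart p q x := by
  refine corePart_expGroup h ?_ ?_ hg x hx
  · rintro _ ⟨c, rfl⟩
    exact ⟨c, isInfTriangular_aMat h c⟩
  · rintro _ ⟨c, rfl⟩ x _
    exact corePart_aMat h c x

theorem corePart_groupN (h : q ≤ p) {g : GLpq p q} (hg : g ∈ groupN h) {x : Vec p q}
    (hx : x ∈ uFlag h q) : corePart p q ((g : Mat p q) *ᵥ x) = corePart p q x :=
  corePart_expGroup h (fun _ hX => ⟨0, isInfTriangular_nSpace h hX⟩)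
    (fun _ hX _ hx => corePart_nSpace h hX hx) hg x hx

theorem K0_mulVec_of_corePart_eq_zero {g : GLpq p q} (hg : g ∈ K0 p q) {x : Vec p q}
    (hx : corePart p q x = 0) : (g : Mat p q) *ᵥ x = x := by
  induction hg using Subgroup.closure_induction with
  | mem g hg =>
    obtain ⟨Y, hY, e⟩ := hg
    rw [e, exp_mulVec_of_eq_zero (k0_mulVec_eq_zero hY hx)]
  | one => simp
  | mul a b _ _ ha hb => rw [Units.val_mul, ← Matrix.mulVec_mulVec, hb, ha]
  | inv a _ ha =>
    conv_lhs => rw [← ha]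
    exact inv_mulVec_mulVec a x

/-- The orbit of a point of the degenerate subspace with definite part `y ≠ 0`. The factors `A`
and `N` only add elements of the span of the `w_i`, which `K'` fixes. -/
theorem orbit_eq_add_wSpan (h : q ≤ p) {K' : Subgroup (GLpq p q)} (hK' : K' ≤ K0 p q)
    {y b : Vec p q} (hy : corePart p q y = y) (hy0 : y ≠ 0) (hb : b ∈ wSpan h) :
    orbit (KAN h K') (y + b) = orbit K' y + (wSpan h : Set (Vec p q)) := by
  obtain ⟨hbu, hbc⟩ := (mem_wSpan_iff h _).1 hb
  have hyu : ∀ i, uCoord h i y = 0 := fun i => by rw [← hy, uCoord_corePart]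
  have hu : ∀ i, uCoord h i (y + b) = 0 := fun i => by rw [map_add, hyu, hbu, add_zero]
  have hc : corePart p q (y + b) = y := by rw [map_add, hy, hbc, add_zero]
  have hfix : ∀ k ∈ K', ∀ d ∈ wSpan h, (k : Mat p q) *ᵥ d = d := fun k hk d hd =>
    K0_mulVec_of_corePart_eq_zero (hK' hk) ((mem_wSpan_iff h d).1 hd).2
  ext x
  constructor
  · rintro ⟨g, hg, rfl⟩
    have hg' : g ∈ (KAN h K' : Set (GLpq p q)) := hg
    rw [coe_KAN h hK'] at hg'
    obtain ⟨_, ⟨k, hk, a, ha, rfl⟩, n, hn, rfl⟩ := hg'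
    have h1 : (n : Mat p q) *ᵥ (y + b) ∈ uFlag h q :=
      (isPosTriangular_of_mem_KAN h hK' (groupN_le_KAN h K' hn)).mem_uFlag _ _
        (mem_uFlag.2 fun i _ => hu i)
    have h2 := (isPosTriangular_of_mem_KAN h hK' (groupA_le_KAN h K' ha)).mem_uFlag _ _ h1
    set z := (a : Mat p q) *ᵥ (n : Mat p q) *ᵥ (y + b) with hz
    have h3 : corePart p q z = y := by
      rw [hz, corePart_groupA h ha h1, corePart_groupN h hn (mem_uFlag.2 fun i _ => hu i), hc]
    have h4 : z - y ∈ wSpan h := (mem_wSpan_iff h _).2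
      ⟨fun i => by rw [map_sub, hyu, mem_uFlag.1 h2 i i.2, sub_zero],
        by rw [map_sub, h3, hy, sub_self]⟩
    refine ⟨(k : Mat p q) *ᵥ y, ⟨k, hk, rfl⟩, z - y, h4, ?_⟩
    simp only [Units.val_mul, ← Matrix.mulVec_mulVec]
    rw [← hz]
    conv_lhs => rw [← hfix k hk _ h4, ← Matrix.mulVec_add, add_sub_cancel]
  · rintro ⟨_, ⟨k, hk, rfl⟩, d, hd, rfl⟩
    obtain ⟨n, hn, hn'⟩ := exists_groupN_translation h hu (by rwa [hc]) (sub_mem hd hb)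
    refine ⟨k * n, mul_mem (Subgroup.mem_sup_left (Subgroup.mem_sup_left hk))
      (groupN_le_KAN h K' hn), ?_⟩
    rw [Units.val_mul, ← Matrix.mulVec_mulVec, hn', add_assoc, add_sub_cancel, Matrix.mulVec_add,
      hfix k hk d hd]

/-- Every nonzero vector has a first nonvanishing null coordinate, or lies in the degenerate
subspace and has a nonzero definite part, or is a combination of the `w_i` with a last
nonvanishing coefficient. -/
theorem vec_trichotomy (h : q ≤ p) {x : Vec p q} (hx : x ≠ 0) :
    (∃ k : Fin q, x ∈ uFlag h k ∧ uCoord h k x ≠ 0) ∨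
      ((∀ i, uCoord h i x = 0) ∧ corePart p q x ≠ 0) ∨
      ∃ l : Fin q, x ∈ Submodule.span ℝ (w h '' Set.Iic l) ∧ vCoord h l x ≠ 0 := by
  classical
  by_cases hu : ∀ i, uCoord h i x = 0
  · by_cases hc : corePart p q x = 0
    · refine Or.inr (Or.inr ?_)
      let S := Finset.univ.filter fun i => vCoord h i x ≠ 0
      have hS : S.Nonempty := by
        by_contra hS
        rw [Finset.not_nonempty_iff_eq_empty, Finset.filter_eq_empty_iff] at hS
        refine hx (ext_coord h (fun i => by simp [hu]) (fun i => ?_) (by simp [hc]))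
        simpa using hS (Finset.mem_univ i)
      refine ⟨S.max' hS, (mem_span_w_iff h _ _).2 ⟨hu, hc, fun i hi => ?_⟩,
        (Finset.mem_filter.1 (S.max'_mem hS)).2⟩
      by_contra hv
      exact hi (S.le_max' i (Finset.mem_filter.2 ⟨Finset.mem_univ _, hv⟩))
    · exact Or.inr (Or.inl ⟨hu, hc⟩)
  · left
    push Not at hu
    let S := Finset.univ.filter fun i => uCoord h i x ≠ 0
    have hS : S.Nonempty := hu.imp fun i hi => Finset.mem_filter.2 ⟨Finset.mem_univ _, hi⟩
    refine ⟨S.min' hS, mem_uFlag.2 fun i hi => ?_, (Finset.mem_filter.1 (S.min'_mem hS)).2⟩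
    by_contra hv
    exact absurd (S.min'_le i (Finset.mem_filter.2 ⟨Finset.mem_univ _, hv⟩)) (not_le.2 hi)

end Orbits

/-! ### Connected components of the level sets -/

section Components

variable {p q : ℕ}

/-- The piece is a graph over a convex set: the coordinate along `w_k` is determined by the others. -/
theorem isPreconnected_levelPiece (h : q ≤ p) (k : Fin q) (ε ρ : ℝ) :
    IsPreconnected (levelPiece h k ε ρ) := by
  let C : Set (Vec p q) := {x | x ∈ uFlag h k ∧ 0 < ε * uCoord h k x}
  have hC : Convex ℝ C := by
    refine (uFlag h k).convex.inter ?_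
    have := convex_halfSpace_gt (𝕜 := ℝ) (f := (ε • uCoord h k : Vec p q →ₗ[ℝ] ℝ))
      (LinearMap.isLinear _) 0
    simp only [LinearMap.smul_apply, smul_eq_mul] at this
    exact this
  let f : Vec p q → Vec p q := fun x => x + ((ρ - form x x) / (2 * uCoord h k x)) • w h k
  have hf : ContinuousOn f C := by
    have h1 : Continuous fun x : Vec p q => form x x := by unfold form; fun_prop
    have h2 : Continuous (uCoord h k) := LinearMap.continuous_of_finiteDimensional _
    refine continuousOn_id.add (ContinuousOn.smul (ContinuousOn.div
      (continuous_const.sub h1).continuousOn (continuous_const.mul h2).continuousOn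
      fun x hx => ?_) continuousOn_const)
    exact mul_ne_zero two_ne_zero (right_ne_zero_of_mul hx.2.ne')
  have : levelPiece h k ε ρ = f '' C := by
    ext y
    constructor
    · rintro ⟨h1, h2, h3⟩
      exact ⟨y, ⟨h1, h2⟩, by simp [f, h3]⟩
    · rintro ⟨x, ⟨h1, h2⟩, rfl⟩
      refine ⟨mem_uFlag.2 fun i hi => ?_, by simpa [f] using h2, ?_⟩
      · simp [f, mem_uFlag.1 h1 i hi]
      · have := right_ne_zero_of_mul h2.ne'
        simp only [f]
        rw [form_add_smul_w]
        field_simp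
        ring
  rw [this]
  exact hC.isPreconnected.image f hf

theorem connectedComponentIn_levelPiece (h : q ≤ p) (k : Fin q) {ε ρ : ℝ} {x : Vec p q}
    (hx : x ∈ levelPiece h k ε ρ) :
    connectedComponentIn (levelPiece h k ε ρ ∪ levelPiece h k (-ε) ρ) x =
      levelPiece h k ε ρ := by
  have hxT : x ∈ levelPiece h k ε ρ ∪ levelPiece h k (-ε) ρ := Or.inl hx
  refine Set.Subset.antisymm ?_ ((isPreconnected_levelPiece h k ε ρ).subset_connectedComponentIn
    hx Set.subset_union_left)
  have hcont : Continuous (uCoord h k) := LinearMap.continuous_of_finiteDimensional _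
  have hsub := connectedComponentIn_subset (levelPiece h k ε ρ ∪ levelPiece h k (-ε) ρ) x
  have key := (isPreconnected_connectedComponentIn (x := x)
    (F := levelPiece h k ε ρ ∪ levelPiece h k (-ε) ρ)).subset_left_of_subset_union
    (u := {y | 0 < ε * uCoord h k y}) (v := {y | 0 < -ε * uCoord h k y})
    (isOpen_lt continuous_const (by fun_prop)) (isOpen_lt continuous_const (by fun_prop))
    (Set.disjoint_left.2 fun y (h1 : 0 < ε * uCoord h k y) (h2 : 0 < -ε * uCoord h k y) => by
      linarith)
    (fun y hy => (hsub hy).imp (fun h => h.2.1) fun h => h.2.1)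
    ⟨x, mem_connectedComponentIn hxT, hx.2.1⟩
  intro y hy
  refine (hsub hy).resolve_right fun h2 => ?_
  have h1 : 0 < ε * uCoord h k y := key hy
  linarith [h2.2.1]

theorem levelPiece_nonempty (h : q ≤ p) (k : Fin q) {ε : ℝ} (hε : ε ≠ 0) (ρ : ℝ) :
    (levelPiece h k ε ρ).Nonempty := by
  refine ⟨ε • zVec h k + (ρ / (4 * ε)) • w h k, mem_uFlag.2 fun i hi => ?_, ?_, ?_⟩
  · have : i ≠ k := by rintro rfl; exact lt_irrefl _ hi
    simp [this]
  · have := mul_self_pos.2 hε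
    simp; nlinarith
  · rw [form_add_smul_w, form_smul_left, form_smul_right, form_zVec_left]
    simp
    field_simp
    ring

theorem levelPiece_ne (h : q ≤ p) (k : Fin q) (ρ : ℝ) :
    levelPiece h k 1 ρ ≠ levelPiece h k (-1) ρ := by
  intro H
  obtain ⟨x, hx⟩ := levelPiece_nonempty h k one_ne_zero ρ
  have h2 := (H ▸ hx : x ∈ levelPiece h k (-1) ρ).2.1
  linarith [hx.2.1]

theorem components_levelPiece (h : q ≤ p) (k : Fin q) (ρ : ℝ) :
    components (levelPiece h k 1 ρ ∪ levelPiece h k (-1) ρ) =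
      {levelPiece h k 1 ρ, levelPiece h k (-1) ρ} := by
  have h1 := fun x hx => connectedComponentIn_levelPiece h k (ε := 1) (ρ := ρ) (x := x) hx
  have h2 := fun x hx => connectedComponentIn_levelPiece h k (ε := -1) (ρ := ρ) (x := x) hx
  simp only [neg_neg] at h2
  simp only [Set.union_comm (levelPiece h k (-1) ρ)] at h2
  ext C
  simp only [components, Set.mem_ofPred_eq, Set.mem_insert_iff, Set.mem_singleton_iff]
  constructor
  · rintro ⟨x, hx | hx, rfl⟩
    · exact Or.inl (h1 x hx)
    · exact Or.inr (h2 x hx)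
  · rintro (rfl | rfl)
    · obtain ⟨x, hx⟩ := levelPiece_nonempty h k one_ne_zero ρ
      exact ⟨x, Or.inl hx, (h1 x hx).symm⟩
    · obtain ⟨x, hx⟩ := levelPiece_nonempty h k (neg_ne_zero.2 one_ne_zero) ρ
      exact ⟨x, Or.inr hx, (h2 x hx).symm⟩

theorem inter_slice_eq (h : q ≤ p) (k : Fin q) {M : Set (Vec p q)} {ρ : ℝ}
    (hM : ∀ x ≠ 0, x ∈ M ↔ form x x = ρ) :
    M ∩ slice h (k + 1) = levelPiece h k 1 ρ ∪ levelPiece h k (-1) ρ := by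
  ext x
  rw [Set.mem_inter_iff, mem_slice_iff]
  have hflag : x ∈ uFlag h k ↔ ∀ i < k, uCoord h i x = 0 := mem_uFlag
  simp only [levelPiece, Set.mem_union, Set.mem_ofPred_eq, hflag]
  constructor
  · rintro ⟨h1, h2, h3⟩
    have h1 := (hM x (by rintro rfl; simp at h3)).1 h1
    rcases h3.lt_or_gt with h3 | h3
    · exact Or.inr ⟨h2, by linarith, h1⟩
    · exact Or.inl ⟨h2, by linarith, h1⟩
  · rintro (⟨h1, h2, h3⟩ | ⟨h1, h2, h3⟩)
    all_goals
      have h4 := right_ne_zero_of_mul h2.ne'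
      exact ⟨(hM x (by rintro rfl; simp at h4)).2 h3, h1, h4⟩

theorem levelPiece_congr (h : q ≤ p) (k : Fin q) {ε δ : ℝ} (hεδ : 0 < ε * δ) (ρ : ℝ) :
    levelPiece h k ε ρ = levelPiece h k δ ρ := by
  ext x
  refine and_congr_right fun _ => and_congr_left fun _ => ?_
  rcases pos_and_pos_or_neg_and_neg_of_mul_pos hεδ with ⟨h1, h2⟩ | ⟨h1, h2⟩
  · rw [mul_pos_iff_of_pos_left h1, mul_pos_iff_of_pos_left h2]
  · rw [← neg_mul_neg, mul_pos_iff_of_pos_left (neg_pos.2 h1), ← neg_mul_neg δ,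
      mul_pos_iff_of_pos_left (neg_pos.2 h2)]

theorem wPiece_congr (h : q ≤ p) (l : Fin q) {ε δ : ℝ} (hεδ : 0 < ε * δ) :
    wPiece h l ε = wPiece h l δ := by
  ext x
  refine and_congr_right fun _ => ?_
  rcases pos_and_pos_or_neg_and_neg_of_mul_pos hεδ with ⟨h1, h2⟩ | ⟨h1, h2⟩
  · rw [mul_pos_iff_of_pos_left h1, mul_pos_iff_of_pos_left h2]
  · rw [← neg_mul_neg, mul_pos_iff_of_pos_left (neg_pos.2 h1), ← neg_mul_neg δ,
      mul_pos_iff_of_pos_left (neg_pos.2 h2)]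

theorem mem_span_w_Iio_add_iff (h : q ≤ p) (l : Fin q) (P : ℝ → Prop) (x : Vec p q) :
    x ∈ (Submodule.span ℝ (w h '' Set.Iio l) : Set (Vec p q)) +
        {v | ∃ t : ℝ, P t ∧ v = t • w h l} ↔
      x ∈ Submodule.span ℝ (w h '' Set.Iic l) ∧ P (vCoord h l x / 2) := by
  constructor
  · rintro ⟨y, hy, _, ⟨t, ht, rfl⟩, rfl⟩
    refine ⟨add_mem (Submodule.span_mono (Set.image_mono Set.Iio_subset_Iic_self) hy)
      (Submodule.smul_mem _ _ (Submodule.subset_span ⟨l, Set.mem_Iic.2 le_rfl, rfl⟩)), ?_⟩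
    simpa [((mem_span_w_iff h _ _).1 hy).2.2 l (by simp)] using ht
  · rintro ⟨hx, ht⟩
    obtain ⟨hu, hc, hv⟩ := (mem_span_w_iff h _ _).1 hx
    refine ⟨x - (vCoord h l x / 2) • w h l, (mem_span_w_iff h _ _).2 ⟨fun i => by simp [hu],
      by simp [hc], fun i hi => ?_⟩, _, ⟨_, ht, rfl⟩, sub_add_cancel _ _⟩
    rcases (not_lt.1 (mt Set.mem_Iio.2 hi)).lt_or_eq with hi | rfl
    · simp [hv i (mt Set.mem_Iic.1 (not_le.2 hi)), hi.ne']
    · simp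

theorem wPos_eq_wPiece (h : q ≤ p) (l : Fin q) : wPos h l = wPiece h l 1 := by
  ext x
  rw [wPos, mem_span_w_Iio_add_iff h l (0 < ·)]
  exact and_congr_right fun _ => by simp

theorem wNeg_eq_wPiece (h : q ≤ p) (l : Fin q) : wNeg h l = wPiece h l (-1) := by
  ext x
  rw [wNeg, mem_span_w_Iio_add_iff h l (· < 0)]
  exact and_congr_right fun _ => ⟨fun h => by linarith, fun h => by linarith⟩

theorem smul_w_mem_wPiece (h : q ≤ p) (l : Fin q) {ε : ℝ} (hε : ε ≠ 0) :
    ε • w h l ∈ wPiece h l ε := by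
  refine ⟨Submodule.smul_mem _ _ (Submodule.subset_span ⟨l, Set.mem_Iic.2 le_rfl, rfl⟩), ?_⟩
  have := mul_self_pos.2 hε
  simp; nlinarith

theorem wPos_ne_wNeg (h : q ≤ p) (l : Fin q) : wPos h l ≠ wNeg h l := by
  rw [wPos_eq_wPiece, wNeg_eq_wPiece]
  intro H
  have h1 := smul_w_mem_wPiece h l (one_ne_zero (α := ℝ))
  have h2 := (H ▸ h1 : (1 : ℝ) • w h l ∈ wPiece h l (-1)).2
  linarith [h1.2]

theorem wPiece_ne_levelPiece (h : q ≤ p) (k l : Fin q) {ε : ℝ} (hε : ε ≠ 0) (δ ρ : ℝ) :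
    wPiece h l ε ≠ levelPiece h k δ ρ := by
  intro H
  have := (H ▸ smul_w_mem_wPiece h l hε : ε • w h l ∈ levelPiece h k δ ρ).2.1
  simp at this

end Components

/-! ### Orbits of a given dimension -/

section Classification

variable {p q : ℕ}

theorem form_self_of_mem_span_w (h : q ≤ p) {l : Fin q} {x : Vec p q}
    (hx : x ∈ Submodule.span ℝ (w h '' Set.Iic l)) : form x x = 0 := by
  obtain ⟨hu, hc, -⟩ := (mem_span_w_iff h _ _).1 hx
  rw [form_self_of_uCoord_eq_zero h hu, hc]
  simp [form]

theorem orbit_of_mem_levelPiece (h : q ≤ p) {K' : Subgroup (GLpq p q)} (hK' : K' ≤ K0 p q)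
    {k : Fin q} {ε ρ : ℝ} {x : Vec p q} (hx : x ∈ levelPiece h k ε ρ) :
    orbit (KAN h K') x = levelPiece h k ε ρ := by
  obtain ⟨h1, h2, rfl⟩ := hx
  rw [orbit_eq_levelPiece h hK' h1 (right_ne_zero_of_mul h2.ne')]
  exact levelPiece_congr h k (by rwa [mul_comm]) _

theorem orbit_of_mem_wPiece (h : q ≤ p) {K' : Subgroup (GLpq p q)} (hK' : K' ≤ K0 p q)
    {l : Fin q} {ε : ℝ} {x : Vec p q} (hx : x ∈ wPiece h l ε) :
    orbit (KAN h K') x = wPiece h l ε := by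
  obtain ⟨h1, h2⟩ := hx
  rw [orbit_eq_wPiece h hK' h1 (right_ne_zero_of_mul h2.ne')]
  exact wPiece_congr h l (by rwa [mul_comm])

/-- Among the points of a level set, those with first nonvanishing null coordinate of index `k`
form exactly two orbits. -/
theorem orbit_levelPiece_iff (h : q ≤ p) {K' : Subgroup (GLpq p q)} (hK' : K' ≤ K0 p q)
    (k : Fin q) {M : Set (Vec p q)} {ρ : ℝ} (hM : ∀ x ≠ 0, x ∈ M ↔ form x x = ρ)
    (O : Set (Vec p q)) :
    (∃ x ∈ M, (x ∈ uFlag h k ∧ uCoord h k x ≠ 0) ∧ O = orbit (KAN h K') x) ↔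
      O ∈ ({levelPiece h k 1 ρ, levelPiece h k (-1) ρ} : Set (Set (Vec p q))) := by
  have key : ∀ x, (x ∈ M ∧ x ∈ uFlag h k ∧ uCoord h k x ≠ 0) ↔
      x ∈ levelPiece h k 1 ρ ∪ levelPiece h k (-1) ρ := by
    intro x
    rw [← inter_slice_eq h k hM, Set.mem_inter_iff, mem_slice_iff]
    exact and_congr_right fun _ => and_congr_left fun _ => mem_uFlag
  constructor
  · rintro ⟨x, hx, hk, rfl⟩
    rcases (key x).1 ⟨hx, hk⟩ with h1 | h1
    · exact Or.inl (orbit_of_mem_levelPiece h hK' h1)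
    · exact Or.inr (orbit_of_mem_levelPiece h hK' h1)
  · rintro (rfl | rfl)
    · obtain ⟨x, hx⟩ := levelPiece_nonempty h k one_ne_zero ρ
      obtain ⟨h1, h2⟩ := (key x).2 (Or.inl hx)
      exact ⟨x, h1, h2, (orbit_of_mem_levelPiece h hK' hx).symm⟩
    · obtain ⟨x, hx⟩ := levelPiece_nonempty h k (neg_ne_zero.2 one_ne_zero) ρ
      obtain ⟨h1, h2⟩ := (key x).2 (Or.inr hx)
      exact ⟨x, h1, h2, (orbit_of_mem_levelPiece h hK' hx).symm⟩

/-- Among the points of the null cone, those of `∑_{i ≤ l} ℝ w_i \ ∑_{i < l} ℝ w_i` form exactly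
two orbits. -/
theorem orbit_wPiece_iff (h : q ≤ p) {K' : Subgroup (GLpq p q)} (hK' : K' ≤ K0 p q)
    (l : Fin q) (O : Set (Vec p q)) :
    (∃ x ∈ nullCone p q, (x ∈ Submodule.span ℝ (w h '' Set.Iic l) ∧ vCoord h l x ≠ 0) ∧
      O = orbit (KAN h K') x) ↔ O ∈ ({wPos h l, wNeg h l} : Set (Set (Vec p q))) := by
  rw [wPos_eq_wPiece, wNeg_eq_wPiece]
  have hnull : ∀ {ε x}, x ∈ wPiece h l ε → x ∈ nullCone p q ∧
      (x ∈ Submodule.span ℝ (w h '' Set.Iic l) ∧ vCoord h l x ≠ 0) := by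
    rintro ε x ⟨h1, h2⟩
    have h3 := right_ne_zero_of_mul h2.ne'
    exact ⟨⟨by rintro rfl; simp at h3, form_self_of_mem_span_w h h1⟩, h1, h3⟩
  constructor
  · rintro ⟨x, -, ⟨h1, h2⟩, rfl⟩
    rcases h2.lt_or_gt with h3 | h3
    · exact Or.inr (orbit_of_mem_wPiece h hK' ⟨h1, by linarith⟩)
    · exact Or.inl (orbit_of_mem_wPiece h hK' ⟨h1, by linarith⟩)
  · rintro (rfl | rfl)
    · have hx := smul_w_mem_wPiece h l (one_ne_zero (α := ℝ))
      exact ⟨_, (hnull hx).1, (hnull hx).2, (orbit_of_mem_wPiece h hK' hx).symm⟩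
    · have hx := smul_w_mem_wPiece h l (neg_ne_zero.2 (one_ne_zero (α := ℝ)))
      exact ⟨_, (hnull hx).1, (hnull hx).2, (orbit_of_mem_wPiece h hK' hx).symm⟩

theorem uCoord_ne_zero_iff_orbitDim (h : q ≤ p) {K' : Subgroup (GLpq p q)} (hK' : K' ≤ K0 p q)
    (k : Fin q) {x : Vec p q} (hx : x ≠ 0)
    (hw : ∀ l : Fin q, x ∈ Submodule.span ℝ (w h '' Set.Iic l) → vCoord h l x ≠ 0 →
      ¬ ((l : ℕ) + 1 = p + q - (k + 1))) :
    orbitDim (KAN h K') x = p + q - (k + 1) ↔ x ∈ uFlag h k ∧ uCoord h k x ≠ 0 := by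
  have hk := k.2
  refine ⟨fun H => ?_, fun H => orbitDim_of_uCoord_ne_zero h hK' H.1 H.2⟩
  rcases vec_trichotomy h hx with ⟨k', h1, h2⟩ | ⟨h1, h2⟩ | ⟨l, h1, h2⟩
  · have := orbitDim_of_uCoord_ne_zero h hK' h1 h2
    have hk' := k'.2
    have : k' = k := Fin.ext (by omega)
    exact this ▸ ⟨h1, h2⟩
  · have := (orbitDim_of_corePart_ne_zero h hK' h1 h2).2
    omega
  · exact absurd ((orbitDim_of_mem_span_w h hK' h1 h2).symm.trans H) (hw l h1 h2)

theorem span_w_iff_orbitDim (h : q ≤ p) {K' : Subgroup (GLpq p q)} (hK' : K' ≤ K0 p q)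
    (l : Fin q) {x : Vec p q} (hx : x ∈ nullCone p q)
    (hu : ∀ k : Fin q, x ∈ uFlag h k → uCoord h k x ≠ 0 → ¬ ((l : ℕ) + 1 = p + q - (k + 1))) :
    orbitDim (KAN h K') x = l + 1 ↔
      x ∈ Submodule.span ℝ (w h '' Set.Iic l) ∧ vCoord h l x ≠ 0 := by
  refine ⟨fun H => ?_, fun H => orbitDim_of_mem_span_w h hK' H.1 H.2⟩
  rcases vec_trichotomy h hx.1 with ⟨k, h1, h2⟩ | ⟨h1, h2⟩ | ⟨l', h1, h2⟩
  · exact absurd (H.symm.trans (orbitDim_of_uCoord_ne_zero h hK' h1 h2)) (hu k h1 h2)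
  · have := form_self_of_uCoord_eq_zero h h1
    rw [hx.2] at this
    exact absurd this (form_corePart_self_pos h2).ne
  · have := orbitDim_of_mem_span_w h hK' h1 h2
    have : l' = l := Fin.ext (by omega)
    exact this ▸ ⟨h1, h2⟩

/-- The orbits of dimension `m ≥ p` in a level set, as long as no combination of the `w_i` in it
has an orbit of the same dimension. -/
theorem orbitsOfDim_eq_components (h : q ≤ p) {K' : Subgroup (GLpq p q)} (hK' : K' ≤ K0 p q)
    {M : Set (Vec p q)} {ρ : ℝ} (hM : ∀ x ≠ 0, x ∈ M ↔ form x x = ρ) (hM0 : (0 : Vec p q) ∉ M)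
    {m : ℕ} (hm : m ∈ Set.Icc p (p + q - 1)) (hq : 1 ≤ q)
    (hw : ∀ x ∈ M, ∀ l : Fin q, x ∈ Submodule.span ℝ (w h '' Set.Iic l) →
      vCoord h l x ≠ 0 → ¬ ((l : ℕ) + 1 = m)) :
    orbitsOfDim (KAN h K') M m = components (M ∩ slice h (p + q - m)) ∧
      (orbitsOfDim (KAN h K') M m).ncard = 2 := by
  obtain ⟨hm1, hm2⟩ := hm
  obtain ⟨k, hk⟩ : ∃ k : Fin q, (k : ℕ) + 1 = p + q - m :=
    ⟨⟨p + q - m - 1, by omega⟩, by simp; omega⟩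
  have hmk : m = p + q - (k + 1) := by omega
  have e : orbitsOfDim (KAN h K') M m = {levelPiece h k 1 ρ, levelPiece h k (-1) ρ} := by
    ext O
    rw [← orbit_levelPiece_iff h hK' k hM, hmk]
    refine exists_congr fun x => and_congr_right fun hx => and_congr_left fun _ => ?_
    refine uCoord_ne_zero_iff_orbitDim h hK' k (by rintro rfl; exact hM0 hx) fun l h1 h2 => ?_
    rw [← hmk]
    exact hw x hx l h1 h2
  rw [e, ← hk, inter_slice_eq h k hM, components_levelPiece]
  exact ⟨rfl, Set.ncard_pair (levelPiece_ne h k ρ)⟩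

/-- Only on the degenerate subspace, at points with nonzero definite part, does the orbit depend on
the factor `K'`. -/
theorem orbit_independent (h : q ≤ p) {K' K'' : Subgroup (GLpq p q)} (hK' : K' ≤ K0 p q)
    (hK'' : K'' ≤ K0 p q) {x : Vec p q} (hx : x ≠ 0)
    (hc : (∀ i, uCoord h i x = 0) → corePart p q x = 0) :
    orbit (KAN h K'') x = orbit (KAN h K') x := by
  rcases vec_trichotomy h hx with ⟨k, h1, h2⟩ | ⟨h1, h2⟩ | ⟨l, h1, h2⟩
  · rw [orbit_eq_levelPiece h hK' h1 h2, orbit_eq_levelPiece h hK'' h1 h2]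
  · exact absurd (hc h1) h2
  · rw [orbit_eq_wPiece h hK' h1 h2, orbit_eq_wPiece h hK'' h1 h2]

theorem mem_nullCone_iff (x : Vec p q) (hx : x ≠ 0) : x ∈ nullCone p q ↔ form x x = 0 :=
  and_iff_right hx

theorem corePart_eq_zero_of_form_nonpos (h : q ≤ p) {x : Vec p q} (hx : form x x ≤ 0)
    (hu : ∀ i, uCoord h i x = 0) : corePart p q x = 0 := by
  by_contra hc
  rw [form_self_of_uCoord_eq_zero h hu] at hx
  exact absurd (form_corePart_self_pos hc) (not_lt.2 hx)

theorem ne_zero_of_form_ne_zero {x : Vec p q} (hx : form x x ≠ 0) : x ≠ 0 := by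
  rintro rfl
  exact hx (by simp [form])

theorem orbitDim_mem_Icc (h : q ≤ p) {K' : Subgroup (GLpq p q)} (hK' : K' ≤ K0 p q)
    {k : Fin q} {x : Vec p q} (hx : x ∈ uFlag h k) (hk : uCoord h k x ≠ 0) :
    orbitDim (KAN h K') x ∈ Set.Icc p (p + q - 1) := by
  rw [orbitDim_of_uCoord_ne_zero h hK' hx hk]
  have := k.2
  constructor <;> omega

theorem mem_coreSphere_iff {r : ℝ} {y : Vec p q} :
    y ∈ coreSphere p q r ↔ corePart p q y = y ∧ form y y = r ^ 2 := by
  constructor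
  · rintro ⟨h1, h2, h3⟩
    refine ⟨?_, ?_⟩
    · ext (i | j)
      · rw [corePart_inl, ite_eq_left_iff]
        exact fun hi => (h1 i (not_lt.1 hi)).symm
      · exact (h2 j).symm
    · rw [← h3]; simp [form, h2, pow_two]
  · rintro ⟨h1, h2⟩
    have h3 : ∀ j : Fin q, y (Sum.inr j) = 0 := fun j => by rw [← h1, corePart_inr]
    refine ⟨fun i hi => ?_, h3, ?_⟩
    · rw [← h1, corePart_inl, if_neg (not_lt.2 hi)]
    · rw [← h2]; simp [form, h3, pow_two]

theorem mem_cylinder_iff (h : q ≤ p) {r : ℝ} {x : Vec p q} :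
    x ∈ cylinder h r ↔ (∀ i, uCoord h i x = 0) ∧ form x x = r ^ 2 := by
  constructor
  · rintro ⟨y, hy, b, hb, rfl⟩
    obtain ⟨h1, h2⟩ := mem_coreSphere_iff.1 hy
    obtain ⟨h3, h4⟩ := (mem_wSpan_iff h b).1 hb
    have hu : ∀ i, uCoord h i (y + b) = 0 := fun i => by
      rw [map_add, h3, ← h1, uCoord_corePart, add_zero]
    refine ⟨hu, ?_⟩
    change form (y + b) (y + b) = _
    rw [form_self_of_uCoord_eq_zero h hu, map_add, h4, h1, add_zero, h2]
  · rintro ⟨hu, hr⟩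
    rw [form_self_of_uCoord_eq_zero h hu] at hr
    exact ⟨corePart p q x, mem_coreSphere_iff.2 ⟨corePart_corePart x, hr⟩,
      x - corePart p q x, (mem_wSpan_iff h _).2 ⟨fun i => by simp [hu], by simp⟩,
      add_sub_cancel _ _⟩

end Classification

end KANOrbits

open KANOrbits
theorem theorem5p6 {p q : ℕ} (hq : 1 ≤ q) (h : q ≤ p)
    (K' : Subgroup (GLpq p q)) (hK' : K' ≤ K0 p q) :
    -- the products `k a n` form a group
    ((KAN h K' : Set (GLpq p q)) =
      (K' : Set (GLpq p q)) * (groupA h : Set (GLpq p q)) * (groupN h : Set (GLpq p q))) ∧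
    -- (a) the null cone
    ((∀ x ∈ nullCone p q,
        orbitDim (KAN h K') x ∈ Set.Icc 1 q ∪ Set.Icc p (p + q - 1)) ∧
      (∀ l : Fin q, ¬ (p = q ∧ (l : ℕ) + 1 = q) →
        orbitsOfDim (KAN h K') (nullCone p q) ((l : ℕ) + 1) = {wPos h l, wNeg h l} ∧
        (orbitsOfDim (KAN h K') (nullCone p q) ((l : ℕ) + 1)).ncard = 2) ∧
      (∀ m ∈ Set.Icc p (p + q - 1), ¬ (p = q ∧ m = p) →
        orbitsOfDim (KAN h K') (nullCone p q) m =
          components (nullCone p q ∩ slice h (p + q - m)) ∧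
        (orbitsOfDim (KAN h K') (nullCone p q) m).ncard = 2) ∧
      (∀ l : Fin q, p = q → (l : ℕ) + 1 = q →
        orbitsOfDim (KAN h K') (nullCone p q) q =
          {wPos h l, wNeg h l} ∪ components (nullCone p q ∩ slice h q) ∧
        (components (nullCone p q ∩ slice h q)).ncard = 2 ∧
        (orbitsOfDim (KAN h K') (nullCone p q) q).ncard = 4) ∧
      (∀ x ∈ nullCone p q, ∀ K'' : Subgroup (GLpq p q), K'' ≤ K0 p q →
        orbit (KAN h K'') x = orbit (KAN h K') x)) ∧
    -- (b) the pseudo-hyperbolic spaces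
    (∀ r : ℝ, 0 < r →
      (∀ x ∈ pseudoHyperbolic p q r, orbitDim (KAN h K') x ∈ Set.Icc p (p + q - 1)) ∧
      (∀ m ∈ Set.Icc p (p + q - 1),
        orbitsOfDim (KAN h K') (pseudoHyperbolic p q r) m =
          components (pseudoHyperbolic p q r ∩ slice h (p + q - m)) ∧
        (orbitsOfDim (KAN h K') (pseudoHyperbolic p q r) m).ncard = 2) ∧
      (∀ x ∈ pseudoHyperbolic p q r, ∀ K'' : Subgroup (GLpq p q), K'' ≤ K0 p q →
        orbit (KAN h K'') x = orbit (KAN h K') x)) ∧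
    -- (c) the pseudo-spheres
    (∀ r : ℝ, 0 < r →
      (∀ x ∈ pseudoSphere p q r, orbitDim (KAN h K') x ∈ Set.Icc q (p + q - 1)) ∧
      (∀ m ∈ Set.Icc p (p + q - 1),
        orbitsOfDim (KAN h K') (pseudoSphere p q r) m =
          components (pseudoSphere p q r ∩ slice h (p + q - m)) ∧
        (orbitsOfDim (KAN h K') (pseudoSphere p q r) m).ncard = 2) ∧
      (∀ x ∈ pseudoSphere p q r, orbitDim (KAN h K') x ∈ Set.Icc p (p + q - 1) →
        ∀ K'' : Subgroup (GLpq p q), K'' ≤ K0 p q →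
          orbit (KAN h K'') x = orbit (KAN h K') x) ∧
      pseudoSphere p q r ∩ degSpace h = cylinder h r ∧
      (∀ x ∈ pseudoSphere p q r, orbitDim (KAN h K') x ∈ Set.Ico q p ↔ x ∈ cylinder h r) ∧
      (∀ y ∈ coreSphere p q r, ∀ s : Fin q → ℝ,
        orbit (KAN h K') (y + ∑ j, s j • w h j) =
          orbit K' y + (wSpan h : Set (Vec p q)))) := by

  refine ⟨coe_KAN h hK', ⟨?_, ?_, ?_, ?_, ?_⟩, fun r hr => ⟨?_, ?_, ?_⟩,
    fun r hr => ⟨?_, ?_, ?_, ?_, ?_, ?_⟩⟩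
  · intro x hx
    rcases vec_trichotomy h hx.1 with ⟨k, h1, h2⟩ | ⟨h1, h2⟩ | ⟨l, h1, h2⟩
    · exact Or.inr (orbitDim_mem_Icc h hK' h1 h2)
    · exact absurd (corePart_eq_zero_of_form_nonpos h hx.2.le h1) h2
    · left
      rw [orbitDim_of_mem_span_w h hK' h1 h2]
      exact ⟨by omega, l.2⟩
  · intro l hl
    have e : orbitsOfDim (KAN h K') (nullCone p q) ((l : ℕ) + 1) = {wPos h l, wNeg h l} := by
      ext O
      rw [← orbit_wPiece_iff h hK' l]
      refine exists_congr fun x => and_congr_right fun hx => and_congr_left fun _ => ?_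
      refine span_w_iff_orbitDim h hK' l hx fun k _ _ hk => hl ?_
      have := l.2
      have := k.2
      omega
    exact ⟨e, by rw [e]; exact Set.ncard_pair (wPos_ne_wNeg h l)⟩
  · intro m hm hpm
    refine orbitsOfDim_eq_components h hK' mem_nullCone_iff (fun h0 => h0.1 rfl) hm hq
      fun x _ l _ _ hl => hpm ?_
    have := hm.1
    have := l.2
    omega
  · intro l hpq hl
    have e2 : components (nullCone p q ∩ slice h q) =
        {levelPiece h l 1 0, levelPiece h l (-1) 0} := by
      have := inter_slice_eq h l (M := nullCone p q) (ρ := 0) mem_nullCone_iff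
      rw [hl] at this
      rw [this, components_levelPiece]
    have hdim : ∀ x ∈ nullCone p q, orbitDim (KAN h K') x = q ↔
        (x ∈ Submodule.span ℝ (w h '' Set.Iic l) ∧ vCoord h l x ≠ 0) ∨
          (x ∈ uFlag h l ∧ uCoord h l x ≠ 0) := by
      intro x hx
      constructor
      · intro H
        rcases vec_trichotomy h hx.1 with ⟨k, h1, h2⟩ | ⟨h1, h2⟩ | ⟨k, h1, h2⟩
        · have := orbitDim_of_uCoord_ne_zero h hK' h1 h2
          have := k.2
          have : k = l := Fin.ext (by omega)
          exact Or.inr (this ▸ ⟨h1, h2⟩)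
        · exact absurd (corePart_eq_zero_of_form_nonpos h hx.2.le h1) h2
        · have := orbitDim_of_mem_span_w h hK' h1 h2
          have : k = l := Fin.ext (by omega)
          exact Or.inl (this ▸ ⟨h1, h2⟩)
      · rintro (⟨h1, h2⟩ | ⟨h1, h2⟩)
        · rw [orbitDim_of_mem_span_w h hK' h1 h2, hl]
        · rw [orbitDim_of_uCoord_ne_zero h hK' h1 h2]; omega
    have e : orbitsOfDim (KAN h K') (nullCone p q) q =
        {wPos h l, wNeg h l} ∪ {levelPiece h l 1 0, levelPiece h l (-1) 0} := by
      ext O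
      rw [Set.mem_union, ← orbit_wPiece_iff h hK' l,
        ← orbit_levelPiece_iff h hK' l mem_nullCone_iff, ← exists_or]
      refine exists_congr fun x => ?_
      rw [← and_or_left]
      refine and_congr_right fun hx => ?_
      rw [← or_and_right, hdim x hx]
    refine ⟨by rw [e, e2], by rw [e2]; exact Set.ncard_pair (levelPiece_ne h l 0), ?_⟩
    rw [e, Set.ncard_union_eq ?_ (Set.toFinite _) (Set.toFinite _),
      Set.ncard_pair (wPos_ne_wNeg h l), Set.ncard_pair (levelPiece_ne h l 0)]
    rw [wPos_eq_wPiece, wNeg_eq_wPiece]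
    have h1 := wPiece_ne_levelPiece h l l (one_ne_zero (α := ℝ))
    have h2 := wPiece_ne_levelPiece h l l (neg_ne_zero.2 (one_ne_zero (α := ℝ)))
    rw [Set.disjoint_left]
    rintro O (rfl | rfl) (H | H)
    exacts [h1 _ _ H, h1 _ _ H, h2 _ _ H, h2 _ _ H]
  · intro x hx K'' hK''
    exact orbit_independent h hK' hK'' hx.1 (corePart_eq_zero_of_form_nonpos h hx.2.le)
  · intro x (hx : form x x = -r ^ 2)
    have hneg : form x x < 0 := by rw [hx]; simpa using pow_pos hr 2
    rcases vec_trichotomy h (ne_zero_of_form_ne_zero hneg.ne) with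
      ⟨k, h1, h2⟩ | ⟨h1, h2⟩ | ⟨l, h1, h2⟩
    · exact orbitDim_mem_Icc h hK' h1 h2
    · exact absurd (corePart_eq_zero_of_form_nonpos h hneg.le h1) h2
    · exact absurd (form_self_of_mem_span_w h h1) hneg.ne
  · intro m hm
    have hr2 : -r ^ 2 ≠ 0 := by simpa using hr.ne'
    refine orbitsOfDim_eq_components h hK' (fun x _ => Iff.rfl) (fun h0 => ?_) hm hq
      fun x hx l h1 _ _ => ?_
    · exact ne_zero_of_form_ne_zero ((show form (0 : Vec p q) 0 = -r ^ 2 from h0).trans_ne hr2) rfl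
    · exact hr2 ((show form x x = -r ^ 2 from hx).symm.trans (form_self_of_mem_span_w h h1))
  · intro x (hx : form x x = -r ^ 2) K'' hK''
    have hneg : form x x < 0 := by rw [hx]; simpa using pow_pos hr 2
    exact orbit_independent h hK' hK'' (ne_zero_of_form_ne_zero hneg.ne)
      (corePart_eq_zero_of_form_nonpos h hneg.le)
  · intro x (hx : form x x = r ^ 2)
    have hpos : 0 < form x x := by rw [hx]; exact pow_pos hr 2
    rcases vec_trichotomy h (ne_zero_of_form_ne_zero hpos.ne') with
      ⟨k, h1, h2⟩ | ⟨h1, h2⟩ | ⟨l, h1, h2⟩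
    · exact Set.Icc_subset_Icc_left h (orbitDim_mem_Icc h hK' h1 h2)
    · obtain ⟨h3, h4⟩ := orbitDim_of_corePart_ne_zero h hK' h1 h2
      exact ⟨h3, by omega⟩
    · exact absurd (form_self_of_mem_span_w h h1) hpos.ne'
  · intro m hm
    have hr2 : r ^ 2 ≠ 0 := by simpa using hr.ne'
    refine orbitsOfDim_eq_components h hK' (fun x _ => Iff.rfl) (fun h0 => ?_) hm hq
      fun x hx l h1 _ _ => ?_
    · exact ne_zero_of_form_ne_zero ((show form (0 : Vec p q) 0 = r ^ 2 from h0).trans_ne hr2) rfl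
    · exact hr2 ((show form x x = r ^ 2 from hx).symm.trans (form_self_of_mem_span_w h h1))
  · intro x (hx : form x x = r ^ 2) hdim K'' hK''
    have hpos : 0 < form x x := by rw [hx]; exact pow_pos hr 2
    refine orbit_independent h hK' hK'' (ne_zero_of_form_ne_zero hpos.ne') fun hu => ?_
    by_contra hc
    exact absurd (orbitDim_of_corePart_ne_zero h hK' hu hc).2 (not_lt.2 hdim.1)
  · ext x
    rw [mem_cylinder_iff, Set.mem_inter_iff, mem_degSpace_iff, and_comm]
    rfl
  · intro x (hx : form x x = r ^ 2)
    have hpos : 0 < form x x := by rw [hx]; exact pow_pos hr 2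
    rw [mem_cylinder_iff]
    constructor
    · intro hdim
      rcases vec_trichotomy h (ne_zero_of_form_ne_zero hpos.ne') with
        ⟨k, h1, h2⟩ | ⟨h1, h2⟩ | ⟨l, h1, h2⟩
      · exact absurd (orbitDim_mem_Icc h hK' h1 h2).1 (not_le.2 hdim.2)
      · exact ⟨h1, hx⟩
      · exact absurd (form_self_of_mem_span_w h h1) hpos.ne'
    · rintro ⟨hu, -⟩
      refine orbitDim_of_corePart_ne_zero h hK' hu fun hc => hpos.ne' ?_
      rw [form_self_of_uCoord_eq_zero h hu, hc]
      simp [form]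
  · intro y hy s
    obtain ⟨h1, h2⟩ := mem_coreSphere_iff.1 hy
    refine orbit_eq_add_wSpan h hK' h1 (ne_zero_of_form_ne_zero (h2.trans_ne (pow_pos hr 2).ne'))
      (sum_mem fun j _ => Submodule.smul_mem _ _ (Submodule.subset_span ⟨j, rfl⟩))
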